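/- **Proposition 3.1.** Fix $\varphi_0\in\mathscr S(\mathbb R^n)$ with $\operatorname{supp}\widehat{\varphi_0}\subset\{2^{-1}\le|\xi|\le 2\}$, $0\le\widehat{\varphi_0}\le 1$ and $\sum_{j\in\mathbb Z}\widehat{\varphi_0}(2^{-j}\xi)=1$ for all $\xi\ne 0$, where $\widehat{g}(\xi)=\int_{\mathbb R^n}e^{-ix\cdot\xi}g(x)\,dx$. Let $\Delta_j u=\mathscr F^{-1}[\widehat{\varphi_0}(2^{-j}\cdot)\,\widehat u\,]$ and, for a tempered distribution $u$, $$\|u\|_{\dot B^s_{p,q}}:=\Big\|\big\{2^{sj}\|\Delta_j u\|_{L^p}\big\}_{j\in\mathbb Z}\Big\|_{\ell^q(\mathbb Z)} .$$ Let $1\le p,q\le\infty$ and let $s\in\mathbb R$ satisfy $s>\frac np-n$. Let $K\ge 1$ be an integer, let $a_1,\dots,a_K\in\mathbb S^{n-1}$ be pairwise distinct, and let $M\ge 1$ be an integer with $M>s$. Then there is a constant $C>0$, depending only on $n,p,q,s,K,a_1,\dots,a_K,M$ and the fixed $\varphi_0$, such that the following holds for all integers $L\ge1$, all $\lambda\in\{2^m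 : m=1,2,\dots\}$ with $\lambda\ge 2^{100}$, all $b_1,\dots,b_L\in\mathbb C$ and all $f_1,\dots,f_K\in\mathscr S(\mathbb R^n)$. Put $$F(x):=\sum_{k=1}^K\sum_{\ell=1}^L b_\ell f_k(x)e^{i\lambda^\ell a_k\cdot x}.$$ Then $$\|F\|_{\dot B^s_{p,q}}\le C\Big\{\sum_{\ell=1}^L\big(\lambda^{s\ell}|b_\ell|\big)^q\Big\}^{\frac1q}\sum_{k=1}^K\|f_k\|_{L^p}+C\sum_{k=1}^K\sum_{\ell=1}^L\lambda^{(s+n(1-\frac1p)-M)\ell}|b_\ell|\,\|\nabla^Mf_k\|_{L^p\cap L^1}$$ and $$\begin{aligned}\|F\|_{\dot B^s_{p,q}}\ge{}& C^{-1}\Big\{\sum_{\ell=1}^L\big(\lambda^{s\ell}|b_\ell|\big)^q\Big\}^{\frac1q}\max_{1\le k\le K}\|f_k\|_{L^p}-C\sum_{k=1}^K\sum_{\ell=1}^L\lambda^{(s-1)\ell}|b_\ell|\,\|\nabla f_k\|_{L^p}\\&-C\sum_{k=1}^K\sum_{\ell=1}^L\lambda^{(s+n(1-\frac1p)-M)\ell}|b_\ell|\,\|\nabla^Mf_k\|_{L^p\cap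 L^1}.\end{aligned}$$ Here $\|g\|_{L^p\cap L^1}=\|g\|_{L^p}+\|g\|_{L^1}$, and for $q=\infty$ the expression $\{\sum_\ell(\cdot)^q\}^{1/q}$ means the maximum over $\ell$. -/

import Mathlib

open MeasureTheory
open scoped ENNReal NNReal SchwartzMap FourierTransform

noncomputable section

namespace OscBesov

/-- The Euclidean space `ℝⁿ`. -/
abbrev Rn (n : ℕ) : Type := EuclideanSpace ℝ (Fin n)

/-! ### Littlewood-Paley decomposition -/

/-- The Fourier transform in the angular convention, `ξ ↦ ∫ e^{-i x·ξ} φ(x) dx`.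
Mathlib's `𝓕 φ` is `η ↦ ∫ e^{-2πi x·η} φ(x) dx`, so the two are related by `ξ = 2π η`. -/
def angularFourier {n : ℕ} (φ : 𝓢(Rn n, ℂ)) (ξ : Rn n) : ℂ :=
  (𝓕 φ) ((2 * Real.pi)⁻¹ • ξ)

/-- The angular Fourier transform `ξ ↦ φ̂₀(2^{-j} ξ)` of `φⱼ(x) = 2^{nj} φ₀(2^j x)`. -/
def dyadicSymbol {n : ℕ} (φ₀ : 𝓢(Rn n, ℂ)) (j : ℤ) (ξ : Rn n) : ℂ :=
  angularFourier φ₀ (((2 : ℝ) ^ (-j)) • ξ)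

/-- `φ₀` generates a homogeneous Littlewood-Paley decomposition: its Fourier transform is supported
in the annulus `1/2 ≤ |ξ| ≤ 2`, takes values in `[0, 1]`, and its dyadic dilates sum to `1` away
from the origin. -/
structure IsLittlewoodPaley {n : ℕ} (φ₀ : 𝓢(Rn n, ℂ)) : Prop where
  supp : tsupport (angularFourier φ₀) ⊆ {ξ : Rn n | 2⁻¹ ≤ ‖ξ‖ ∧ ‖ξ‖ ≤ 2}
  mem_Icc : ∀ ξ : Rn n, ∃ t ∈ Set.Icc (0 : ℝ) 1, angularFourier φ₀ ξ = (t : ℂ)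
  hasSum_one : ∀ ξ : Rn n, ξ ≠ 0 → HasSum (fun j : ℤ => dyadicSymbol φ₀ j ξ) 1

/-- The Littlewood-Paley block `Δⱼ u = 𝓕⁻¹[φ̂ⱼ û]` of a tempered distribution. Mathlib's Fourier
multipliers take the symbol as a function of `η = ξ / (2π)`. -/
def lpBlock {n : ℕ} (φ₀ : 𝓢(Rn n, ℂ)) (j : ℤ) : 𝓢'(Rn n, ℂ) →L[ℂ] 𝓢'(Rn n, ℂ) :=
  TemperedDistribution.fourierMultiplierCLM ℂ
    (fun η : Rn n => dyadicSymbol φ₀ j ((2 * Real.pi) • η))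

/-- The symbol of a Littlewood-Paley block is an admissible (tempered) Fourier multiplier. -/
theorem hasTemperateGrowth_lpBlock_symbol {n : ℕ} (φ₀ : 𝓢(Rn n, ℂ)) (j : ℤ) :
    Function.HasTemperateGrowth (fun η : Rn n => dyadicSymbol φ₀ j ((2 * Real.pi) • η)) := by
  have h := (𝓕 φ₀).hasTemperateGrowth.comp
    (((2 * Real.pi)⁻¹ • ((2 : ℝ) ^ (-j)) • (2 * Real.pi) •
      ContinuousLinearMap.id ℝ (Rn n)).hasTemperateGrowth)
  exact h

/-- The `L^p` norm of a tempered distribution: the `L^p` norm of the (unique) `L^p` function that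
represents it, and `∞` if there is none. -/
def distLpNorm {n : ℕ} (p : ℝ≥0∞) [Fact (1 ≤ p)] (u : 𝓢'(Rn n, ℂ)) : ℝ≥0∞ :=
  ⨅ (g : Lp ℂ p (volume : Measure (Rn n))) (_ : (g : 𝓢'(Rn n, ℂ)) = u), ‖g‖ₑ

/-- The `ℓ^q` norm of a family of nonnegative numbers, with the supremum for `q = ∞`. -/
def lqNorm {ι : Type*} (q : ℝ≥0∞) (a : ι → ℝ≥0∞) : ℝ≥0∞ :=
  if q = ∞ then ⨆ i, a i else (∑' i, a i ^ q.toReal) ^ (q.toReal)⁻¹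

/-- The homogeneous Besov norm `‖u‖_{Ḃ^s_{p,q}} = ‖(2^{sj} ‖Δⱼ u‖_{L^p})_{j ∈ ℤ}‖_{ℓ^q}`. -/
def besovNorm {n : ℕ} (φ₀ : 𝓢(Rn n, ℂ)) (s : ℝ) (p q : ℝ≥0∞) [Fact (1 ≤ p)]
    (u : 𝓢'(Rn n, ℂ)) : ℝ≥0∞ :=
  lqNorm q fun j : ℤ => ENNReal.ofReal ((2 : ℝ) ^ (s * j)) * distLpNorm p (lpBlock φ₀ j u)

/-! ### Norms of the amplitudes -/

/-- `‖∇^m f‖_{L^p}`, where `|∇^m f(x)|` is the operator norm of the `m`-th derivative. -/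
def gradLpNorm {n : ℕ} (m : ℕ) (p : ℝ≥0∞) (f : 𝓢(Rn n, ℂ)) : ℝ≥0∞ :=
  eLpNorm (iteratedFDeriv ℝ m (f : Rn n → ℂ)) p volume

/-- `‖∇^m f‖_{L^p ∩ L^1}`. -/
def gradLpL1Norm {n : ℕ} (m : ℕ) (p : ℝ≥0∞) (f : 𝓢(Rn n, ℂ)) : ℝ≥0∞ :=
  gradLpNorm m p f + gradLpNorm m 1 f

/-! ### Superpositions of modulated amplitudes -/

/-- The plane wave `x ↦ e^{i r a·x}`. -/
def planeWave {n : ℕ} (r : ℝ) (a : Rn n) (x : Rn n) : ℂ :=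
  Complex.exp (Complex.I * ((r * inner ℝ a x : ℝ) : ℂ))

theorem hasTemperateGrowth_planeWave {n : ℕ} (r : ℝ) (a : Rn n) :
    Function.HasTemperateGrowth (planeWave r a) := by
  have hd : ∀ m : ℕ, iteratedDeriv m (fun t : ℝ => Complex.exp (Complex.I * (t : ℂ)))
      = fun t : ℝ => Complex.I ^ m * Complex.exp (Complex.I * (t : ℂ)) := by
    intro m
    induction m with
    | zero => simp
    | succ m ih =>
      rw [iteratedDeriv_succ, ih]
      funext t
      have h : HasDerivAt (fun t : ℝ => Complex.I * (t : ℂ)) (Complex.I * 1) t :=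
        (HasDerivAt.ofReal_comp (hasDerivAt_id t)).const_mul Complex.I
      rw [(h.cexp.const_mul (Complex.I ^ m)).deriv]
      ring
  have he : Function.HasTemperateGrowth
      (fun t : ℝ => Complex.exp (Complex.I * (t : ℂ))) := by
    refine ⟨(contDiff_const.mul Complex.ofRealCLM.contDiff).cexp, fun m => ⟨0, 1, fun t => ?_⟩⟩
    rw [norm_iteratedFDeriv_eq_norm_iteratedDeriv, hd m]
    simp [mul_comm Complex.I, Complex.norm_exp_ofReal_mul_I]
  exact he.comp ((r • innerSL ℝ a).hasTemperateGrowth)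

/-- The Schwartz function
`F(x) = ∑_{k} ∑_{ℓ=1}^L b_ℓ f_k(x) e^{i λ^ℓ a_k·x}`; see `oscSum_apply`. -/
def oscSum {n K : ℕ} (a : Fin K → Rn n) (L : ℕ) (lam : ℝ) (b : ℕ → ℂ)
    (f : Fin K → 𝓢(Rn n, ℂ)) : 𝓢(Rn n, ℂ) :=
  ∑ k : Fin K, ∑ l ∈ Finset.Icc 1 L,
    b l • SchwartzMap.smulLeftCLM ℂ (planeWave (lam ^ l) (a k)) (f k)

theorem oscSum_apply {n K : ℕ} (a : Fin K → Rn n) (L : ℕ) (lam : ℝ) (b : ℕ → ℂ)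
    (f : Fin K → 𝓢(Rn n, ℂ)) (x : Rn n) :
    oscSum a L lam b f x = ∑ k : Fin K, ∑ l ∈ Finset.Icc 1 L,
      b l * f k x * Complex.exp (Complex.I * ((lam ^ l * inner ℝ (a k) x : ℝ) : ℂ)) := by
  simp only [oscSum, sum_apply, smul_apply,
    SchwartzMap.smulLeftCLM_apply_apply (hasTemperateGrowth_planeWave _ _), smul_eq_mul, planeWave]
  refine Finset.sum_congr rfl fun k _ => Finset.sum_congr rfl fun l _ => ?_
  ring

/-- `{∑_{ℓ=1}^L (λ^{sℓ} |b_ℓ|)^q}^{1/q}`, with the maximum over `ℓ` for `q = ∞`. -/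
def coeffNorm (s : ℝ) (q : ℝ≥0∞) (L : ℕ) (lam : ℝ) (b : ℕ → ℂ) : ℝ≥0∞ :=
  lqNorm q fun l : Finset.Icc 1 L => ENNReal.ofReal (lam ^ (s * (l : ℕ)) * ‖b l‖)

end OscBesov

end

noncomputable section

namespace OscBesov

/-! The j-th block is convolution with `dilate (2^j) φ₀`, and for λ = 2^m the carrier e^{iλ^ℓ a_k·x}
has frequency 2^{mℓ}, since |a_k| = 1. Layer ℓ therefore lives essentially in the blocks with |j -
mℓ| ≤ 2. At a fixed offset different layers occupy different blocks, which is where the ℓ^q norm of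
λ^{sℓ}|b_ℓ| comes from.

Far blocks (`exists_far_bound`): let 2^i be the carrier frequency and |j - i| ≥ 3. The spectrum of
the j-th kernel, recentred at the carrier, misses the ball of radius R = 2^{max(i,j)-2}. A kernel
κ_R of integral one with spectrum in that ball is annihilated by the block, so the amplitude f may
be replaced by (1 - κ_R *)^M f, whose norm is at most a constant times R^{-M}‖∇^M f‖. Relative to
the error term of the theorem, Young's inequality L¹ * L^p gives decay 2^{-(M-s)(j-i)} for j > i.
For j < i, L^p * L¹ costs 2^{jn(1-1/p)} and leaves 2^{-(s+n-n/p)(i-j)}. The hypotheses M > s and s >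
n/p - n make the two sides summable.

Upper bound (`exists_upper_bound`): Young's inequality on the five near blocks of each layer, and
the decay above on all the others.

Lower bound (`exists_lower_bound`): a kernel dilated to frequency N = λ^ℓ acts on e^{iN a·x} f as
multiplication by its symbol at a, up to N^{-1}‖∇f‖_{L^p}. A symbol equal to 1 at a_k, 0 at the
other directions and supported near the unit sphere thus extracts b_ℓ f_k from layer ℓ. Such a
kernel sees only three blocks of F, hence is controlled by the Besov norm, and in these blocks all
other layers are far. -/

/-! ### Minkowski's inequality for averages of translates. -/

/-- An almost everywhere bound holds on a dense set, and by continuity the set is closed. The bound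
is needed at every point because translates are averaged over an arbitrary measure, which could
charge a null set. -/
theorem enorm_le_eLpNorm_top_of_continuous {n : ℕ} {G : Type*} [NormedAddCommGroup G]
    {v : Rn n → G} (hv : Continuous v) (x : Rn n) : ‖v x‖ₑ ≤ eLpNorm v ∞ volume := by
  have h1 : ∀ᵐ y ∂(volume : Measure (Rn n)), ‖v y‖ₑ ≤ eLpNorm v ∞ volume := by
    rw [eLpNorm_exponent_top]; exact ae_le_eLpNormEssSup
  have hd := Measure.dense_of_ae h1
  have hc : IsClosed {y | ‖v y‖ₑ ≤ eLpNorm v ∞ volume} :=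
    isClosed_le hv.enorm continuous_const
  have := hd.closure_eq
  rw [hc.closure_eq] at this
  have hx : x ∈ {y | ‖v y‖ₑ ≤ eLpNorm v ∞ volume} := this ▸ Set.mem_univ x
  exact hx

/-- Minkowski's integral inequality for an average of translates. -/
theorem eLpNorm_le_of_enorm_le_lintegral_translate {n : ℕ} {F G Y : Type*}
    [NormedAddCommGroup F] [NormedAddCommGroup G] [MeasurableSpace Y]
    {p : ℝ≥0∞} (hp : 1 ≤ p) (μ : Measure Y) [IsFiniteMeasure μ] {σ : Y → Rn n}
    (hσ : Measurable σ) {v : Rn n → G} (hv : Continuous v) {h : Rn n → F}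
    (hh : ∀ x, ‖h x‖ₑ ≤ ∫⁻ y, ‖v (x - σ y)‖ₑ ∂μ) :
    eLpNorm h p volume ≤ μ Set.univ * eLpNorm v p volume := by
  rcases eq_or_ne p ∞ with rfl | hp'
  · rw [eLpNorm_exponent_top (f := h)]
    refine eLpNormEssSup_le_of_ae_enorm_bound (Filter.Eventually.of_forall fun x => ?_)
    calc ‖h x‖ₑ ≤ ∫⁻ y, ‖v (x - σ y)‖ₑ ∂μ := hh x
      _ ≤ ∫⁻ y, eLpNorm v ∞ volume ∂μ :=
        lintegral_mono fun y => enorm_le_eLpNorm_top_of_continuous hv _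
      _ = _ := by rw [lintegral_const, mul_comm]
  · have hp0 : p ≠ 0 := (zero_lt_one.trans_le hp).ne'
    set r := p.toReal with hr
    have hr0 : 0 < r := ENNReal.toReal_pos hp0 hp'
    have hmeas : Measurable (fun z : Rn n × Y => ‖v (z.1 - σ z.2)‖ₑ ^ r) :=
      (hv.enorm.measurable.comp (measurable_fst.sub (hσ.comp measurable_snd))).pow_const r
    -- Jensen for the finite measure μ: passing from L¹ to L^r costs the power r - 1 of its mass.
    have hjen : ∀ x, ‖h x‖ₑ ^ r ≤
        (μ Set.univ) ^ (r - 1) * ∫⁻ y, ‖v (x - σ y)‖ₑ ^ r ∂μ := by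
      intro x
      have hms : AEStronglyMeasurable (fun y => ‖v (x - σ y)‖) μ :=
        (hv.norm.measurable.comp (measurable_const.sub hσ)).aestronglyMeasurable
      have := eLpNorm_le_eLpNorm_mul_rpow_measure_univ hp hms
      rw [eLpNorm_one_eq_lintegral_enorm, eLpNorm_eq_lintegral_rpow_enorm_toReal hp0 hp'] at this
      simp only [enorm_norm, ENNReal.toReal_one] at this
      calc ‖h x‖ₑ ^ r ≤ ((∫⁻ y, ‖v (x - σ y)‖ₑ ^ r ∂μ) ^ (1 / r) *
            μ Set.univ ^ (1 / 1 - 1 / r)) ^ r := by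
            gcongr; exact (hh x).trans this
        _ = _ := by
            rw [ENNReal.mul_rpow_of_nonneg _ _ hr0.le, ← ENNReal.rpow_mul, ← ENNReal.rpow_mul,
              one_div_mul_cancel hr0.ne', ENNReal.rpow_one, mul_comm]
            congr 2
            field_simp
    have htr : ∀ y, ∫⁻ x, ‖v (x - σ y)‖ₑ ^ r = ∫⁻ x, ‖v x‖ₑ ^ r := fun y =>
      lintegral_sub_right_eq_self (fun x => ‖v x‖ₑ ^ r) (σ y)
    rw [eLpNorm_eq_lintegral_rpow_enorm_toReal hp0 hp',
      eLpNorm_eq_lintegral_rpow_enorm_toReal hp0 hp']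
    calc (∫⁻ x, ‖h x‖ₑ ^ r) ^ (1 / r)
        ≤ (∫⁻ x, (μ Set.univ) ^ (r - 1) * ∫⁻ y, ‖v (x - σ y)‖ₑ ^ r ∂μ) ^ (1 / r) := by
          gcongr with x; exact hjen x
      _ = ((μ Set.univ) ^ r * ∫⁻ x, ‖v x‖ₑ ^ r) ^ (1 / r) := by
          have hr1 : 1 ≤ r := by
            rw [hr, ← ENNReal.toReal_one]; exact ENNReal.toReal_mono hp' hp
          rw [lintegral_const_mul' _ _ (ENNReal.rpow_ne_top_of_nonneg (by linarith)
            (measure_ne_top _ _)), lintegral_lintegral_swap hmeas.aemeasurable]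
          simp only [htr]
          rw [lintegral_const, mul_comm (∫⁻ x, _), ← mul_assoc]
          congr 2
          nth_rewrite 2 [← ENNReal.rpow_one (μ Set.univ)]
          rw [← ENNReal.rpow_add_of_nonneg _ _ (by linarith) zero_le_one]
          simp
      _ = _ := by
          rw [ENNReal.mul_rpow_of_nonneg _ _ (by positivity), ← ENNReal.rpow_mul,
            mul_one_div_cancel hr0.ne', ENNReal.rpow_one]

/-- Weighted form of `eLpNorm_le_of_enorm_le_lintegral_translate`. -/
theorem eLpNorm_le_of_enorm_le_lintegral_mul_translate {n : ℕ} {F G Y : Type*}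
    [NormedAddCommGroup F] [NormedAddCommGroup G] [MeasurableSpace Y]
    {p : ℝ≥0∞} (hp : 1 ≤ p) (ν : Measure Y) {w : Y → ℝ≥0∞} (hw : Measurable w)
    (hwi : ∫⁻ y, w y ∂ν ≠ ∞) {σ : Y → Rn n}
    (hσ : Measurable σ) {v : Rn n → G} (hv : Continuous v) {h : Rn n → F}
    (hh : ∀ x, ‖h x‖ₑ ≤ ∫⁻ y, w y * ‖v (x - σ y)‖ₑ ∂ν) :
    eLpNorm h p volume ≤ (∫⁻ y, w y ∂ν) * eLpNorm v p volume := by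
  have := isFiniteMeasure_withDensity hwi
  have key := eLpNorm_le_of_enorm_le_lintegral_translate (h := h) hp (ν.withDensity w) hσ hv ?_
  · simpa [withDensity_apply] using key
  · intro x
    have hm : Measurable fun y => ‖v (x - σ y)‖ₑ :=
      hv.enorm.measurable.comp (measurable_const.sub hσ)
    rw [lintegral_withDensity_eq_lintegral_mul _ hw hm]
    exact hh x

/-! ### Convolution of Schwartz functions and Young's inequalities. -/

section Convolution

variable {n : ℕ} {F : Type*} [NormedAddCommGroup F] [NormedSpace ℂ F]

/-- Convolution of a vector-valued Schwartz function with a scalar Schwartz kernel. -/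
def schwartzConv (κ : 𝓢(Rn n, ℂ)) : 𝓢(Rn n, F) →L[ℂ] 𝓢(Rn n, F) :=
  SchwartzMap.convolution (ContinuousLinearMap.lsmul ℂ ℂ) κ

theorem fourier_schwartzConv [CompleteSpace F] (κ : 𝓢(Rn n, ℂ)) (g : 𝓢(Rn n, F)) (ξ : Rn n) :
    𝓕 (schwartzConv κ g) ξ = 𝓕 κ ξ • 𝓕 g ξ := by
  rw [schwartzConv, SchwartzMap.fourier_convolution]
  rfl

theorem schwartzConv_apply [CompleteSpace F] (κ : 𝓢(Rn n, ℂ)) (g : 𝓢(Rn n, F)) (x : Rn n) :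
    schwartzConv κ g x = ∫ y, κ y • g (x - y) := by
  rw [schwartzConv, SchwartzMap.convolution_apply]
  rfl

theorem schwartz_ext_fourier [CompleteSpace F] {f g : 𝓢(Rn n, F)} (h : ∀ ξ, 𝓕 f ξ = 𝓕 g ξ) :
    f = g := by
  have : 𝓕 f = 𝓕 g := SchwartzMap.ext h
  calc f = 𝓕⁻ (𝓕 f) := (FourierTransform.fourierInv_fourier_eq f).symm
    _ = 𝓕⁻ (𝓕 g) := by rw [this]
    _ = g := FourierTransform.fourierInv_fourier_eq g

theorem integrable_smul_translate [CompleteSpace F] (κ : 𝓢(Rn n, ℂ)) (g : 𝓢(Rn n, F)) (x : Rn n) :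
    Integrable fun y => κ y • g (x - y) := by
  refine Integrable.smul_bdd (C := SchwartzMap.seminorm ℝ 0 0 g) κ.integrable
    (g.continuous.comp (continuous_const.sub continuous_id)).aestronglyMeasurable
    (Filter.Eventually.of_forall fun y => SchwartzMap.norm_le_seminorm ℝ g _)

theorem enorm_schwartzConv_le [CompleteSpace F] (κ : 𝓢(Rn n, ℂ)) (g : 𝓢(Rn n, F)) (x : Rn n) :
    ‖schwartzConv κ g x‖ₑ ≤ ∫⁻ y, ‖κ y‖ₑ * ‖g (x - y)‖ₑ := by
  rw [schwartzConv_apply]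
  refine (enorm_integral_le_lintegral_enorm _).trans_eq ?_
  simp only [enorm_smul]

theorem lintegral_enorm_ne_top (g : 𝓢(Rn n, F)) : ∫⁻ y, ‖g y‖ₑ ≠ ∞ := by
  have := (g.memLp 1 volume).eLpNorm_ne_top
  rwa [eLpNorm_one_eq_lintegral_enorm] at this

/-- Young's inequality `L¹ * L^p → L^p`. -/
theorem eLpNorm_schwartzConv_le [CompleteSpace F] {p : ℝ≥0∞} (hp : 1 ≤ p) (κ : 𝓢(Rn n, ℂ))
    (g : 𝓢(Rn n, F)) :
    eLpNorm (schwartzConv κ g) p volume ≤ eLpNorm κ 1 volume * eLpNorm g p volume := by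
  rw [eLpNorm_one_eq_lintegral_enorm]
  exact eLpNorm_le_of_enorm_le_lintegral_mul_translate hp volume κ.continuous.enorm.measurable
    (lintegral_enorm_ne_top κ) measurable_id g.continuous (enorm_schwartzConv_le κ g)

/-- Young's inequality `L^p * L¹ → L^p`. -/
theorem eLpNorm_schwartzConv_le' [CompleteSpace F] {p : ℝ≥0∞} (hp : 1 ≤ p) (κ : 𝓢(Rn n, ℂ))
    (g : 𝓢(Rn n, F)) :
    eLpNorm (schwartzConv κ g) p volume ≤ eLpNorm κ p volume * eLpNorm g 1 volume := by
  rw [mul_comm, eLpNorm_one_eq_lintegral_enorm]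
  refine eLpNorm_le_of_enorm_le_lintegral_mul_translate hp volume g.continuous.enorm.measurable
    (lintegral_enorm_ne_top g) measurable_id κ.continuous fun x =>
      (enorm_schwartzConv_le κ g x).trans_eq ?_
  -- The substitution y ↦ x - y exchanges the roles of kernel and function.
  rw [← lintegral_sub_left_eq_self _ x]
  simp [mul_comm]

-- On the Fourier side both operations are multiplications by scalar functions, which commute.
open LineDeriv in
theorem lineDerivOp_schwartzConv [CompleteSpace F] (κ : 𝓢(Rn n, ℂ)) (g : 𝓢(Rn n, F)) (v : Rn n) :
    ∂_{v} (schwartzConv κ g) = schwartzConv κ (∂_{v} g) := by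
  refine schwartz_ext_fourier fun ξ => ?_
  have hg : (inner ℝ · v : Rn n → ℝ).HasTemperateGrowth := by fun_prop
  rw [fourier_schwartzConv, SchwartzMap.fourier_lineDerivOp_eq, SchwartzMap.fourier_lineDerivOp_eq,
    smul_apply, smul_apply, SchwartzMap.smulLeftCLM_apply_apply hg,
    SchwartzMap.smulLeftCLM_apply_apply hg, fourier_schwartzConv, smul_comm (𝓕 κ ξ),
    smul_comm (𝓕 κ ξ)]

theorem fderivCLM_schwartzConv [CompleteSpace F] (κ : 𝓢(Rn n, ℂ)) (g : 𝓢(Rn n, F)) :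
    SchwartzMap.fderivCLM ℂ (Rn n) F (schwartzConv κ g) =
      schwartzConv κ (SchwartzMap.fderivCLM ℂ (Rn n) F g) := by
  ext x v
  have h := congrArg (fun f : 𝓢(Rn n, F) => f x) (lineDerivOp_schwartzConv κ g v)
  simp only [SchwartzMap.lineDerivOp_apply_eq_fderiv] at h
  rw [SchwartzMap.fderivCLM_apply, h, schwartzConv_apply, schwartzConv_apply,
    ContinuousLinearMap.integral_apply (integrable_smul_translate _ _ _)]
  rfl

end Convolution

/-! ### Dilations of kernels. -/

section Dilation

variable {n : ℕ}

/-- The `L¹`-normalised dilation `x ↦ R^n κ(R x)` of a Schwartz function, for `R > 0`. -/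
def dilate (R : ℝ) (κ : 𝓢(Rn n, ℂ)) : 𝓢(Rn n, ℂ) :=
  if h : R = 0 then 0 else
    ((R : ℂ) ^ n) • SchwartzMap.compCLMOfContinuousLinearEquiv ℂ
      (ContinuousLinearEquiv.smulLeft (Units.mk0 R h) : Rn n ≃L[ℝ] Rn n) κ

theorem dilate_apply {R : ℝ} (hR : 0 < R) (κ : 𝓢(Rn n, ℂ)) (x : Rn n) :
    dilate R κ x = (R : ℂ) ^ n * κ (R • x) := by
  rw [dilate, dif_neg hR.ne']
  rfl

theorem fourier_dilate {R : ℝ} (hR : 0 < R) (κ : 𝓢(Rn n, ℂ)) (ξ : Rn n) :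
    𝓕 (dilate R κ) ξ = 𝓕 κ (R⁻¹ • ξ) := by
  rw [SchwartzMap.fourier_coe, SchwartzMap.fourier_coe, Real.fourier_eq, Real.fourier_eq]
  have := Measure.integral_comp_smul (volume : Measure (Rn n))
    (fun x => Real.fourierChar (-inner ℝ x (R⁻¹ • ξ)) • κ x) R
  simp only [finrank_euclideanSpace, Fintype.card_fin] at this
  rw [abs_of_pos (by positivity), eq_inv_smul_iff₀ (by positivity)] at this
  rw [← this, ← integral_smul]
  congr 1
  ext x
  rw [dilate_apply hR, inner_smul_left, inner_smul_right]
  simp [Circle.smul_def, hR.ne']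
  ring

/-- Source of the exponent n(1 - 1/p) in the error terms. Since `(p⁻¹).toReal` is 0 at p = ∞, one
formula covers every p. -/
theorem eLpNorm_dilate {R : ℝ} (hR : 0 < R) {p : ℝ≥0∞} (hp : 1 ≤ p) (κ : 𝓢(Rn n, ℂ)) :
    eLpNorm (dilate R κ) p volume =
      ENNReal.ofReal (R ^ ((n : ℝ) * (1 - (p⁻¹).toReal))) * eLpNorm κ p volume := by
  have h1 : (dilate R κ : Rn n → ℂ) = ((R : ℂ) ^ n) • (κ ∘ fun x => R • x) := by
    ext x; rw [dilate_apply hR]; rfl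
  have h2 : eLpNorm (κ ∘ fun x : Rn n => R • x) p volume =
      ENNReal.ofReal (R ^ (-(n : ℝ) * (p⁻¹).toReal)) * eLpNorm κ p volume := by
    have hm : Measurable fun x : Rn n => R • x := measurable_const_smul R
    rw [← eLpNorm_map_measure κ.continuous.aestronglyMeasurable hm.aemeasurable,
      Measure.map_addHaar_smul _ hR.ne']
    simp only [finrank_euclideanSpace, Fintype.card_fin]
    rw [abs_of_pos (by positivity)]
    rcases eq_or_ne p ∞ with rfl | hp'
    · rw [eLpNorm_exponent_top, eLpNorm_exponent_top, eLpNormEssSup_ennreal_smul_measure]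
      · simp
      · simp; positivity
    · rw [eLpNorm_smul_measure_of_ne_top hp', smul_eq_mul, one_div,
        ENNReal.ofReal_rpow_of_nonneg (by positivity) (by positivity)]
      congr 2
      rw [Real.rpow_mul hR.le, Real.rpow_neg hR.le, Real.rpow_natCast]
  rw [h1, eLpNorm_const_smul, h2, ← mul_assoc]
  congr 1
  rw [← ofReal_norm, norm_pow, Complex.norm_real, Real.norm_of_nonneg hR.le,
    ← ENNReal.ofReal_mul (by positivity), ← Real.rpow_natCast, ← Real.rpow_add hR]
  congr 2
  ring

theorem eLpNorm_one_dilate {R : ℝ} (hR : 0 < R) (κ : 𝓢(Rn n, ℂ)) :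
    eLpNorm (dilate R κ) 1 volume = eLpNorm κ 1 volume := by
  rw [eLpNorm_dilate hR le_rfl]; simp

end Dilation

/-! ### Modulation by plane waves. -/

section Modulation

variable {n : ℕ}

/-- Multiplication of a Schwartz function by the plane wave `e^{i r a·x}`. -/
def modulate (r : ℝ) (a : Rn n) : 𝓢(Rn n, ℂ) →L[ℂ] 𝓢(Rn n, ℂ) :=
  SchwartzMap.smulLeftCLM ℂ (planeWave r a)

theorem modulate_apply (r : ℝ) (a : Rn n) (f : 𝓢(Rn n, ℂ)) (x : Rn n) :
    modulate r a f x = planeWave r a x * f x := by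
  rw [modulate, SchwartzMap.smulLeftCLM_apply_apply (hasTemperateGrowth_planeWave r a), smul_eq_mul]

theorem norm_planeWave (r : ℝ) (a x : Rn n) : ‖planeWave r a x‖ = 1 := by
  rw [planeWave, mul_comm, Complex.norm_exp_ofReal_mul_I]

theorem eLpNorm_modulate (r : ℝ) (a : Rn n) (f : 𝓢(Rn n, ℂ)) (p : ℝ≥0∞) :
    eLpNorm (modulate r a f) p volume = eLpNorm f p volume := by
  refine eLpNorm_congr_norm_ae (Filter.Eventually.of_forall fun x => ?_)
  rw [modulate_apply, norm_mul, norm_planeWave, one_mul]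

theorem fourier_modulate (r : ℝ) (a : Rn n) (f : 𝓢(Rn n, ℂ)) (ξ : Rn n) :
    𝓕 (modulate r a f) ξ = 𝓕 f (ξ - ((2 * Real.pi)⁻¹ * r) • a) := by
  rw [SchwartzMap.fourier_coe, SchwartzMap.fourier_coe, Real.fourier_eq', Real.fourier_eq']
  congr 1
  ext x
  rw [modulate_apply, planeWave, smul_eq_mul, smul_eq_mul, ← mul_assoc, ← Complex.exp_add]
  congr 2
  rw [inner_sub_right, inner_smul_right, real_inner_comm x a]
  have : (Real.pi : ℂ) ≠ 0 := by exact_mod_cast Real.pi_ne_zero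
  push_cast
  field_simp
  ring

/-- Convolution with `κ` of a modulated function. -/
theorem schwartzConv_modulate (κ f : 𝓢(Rn n, ℂ)) (r : ℝ) (a : Rn n) :
    schwartzConv κ (modulate r a f) = modulate r a (schwartzConv (modulate (-r) a κ) f) := by
  refine schwartz_ext_fourier fun ξ => ?_
  rw [fourier_schwartzConv, fourier_modulate, fourier_modulate, fourier_schwartzConv,
    fourier_modulate]
  congr 2
  rw [sub_sub, ← add_smul]
  simp

theorem modulate_dilate (κ : 𝓢(Rn n, ℂ)) {R : ℝ} (hR : 0 < R) (r : ℝ) (a : Rn n) :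
    modulate (R * r) a (dilate R κ) = dilate R (modulate r a κ) := by
  ext x
  rw [modulate_apply, dilate_apply hR, dilate_apply hR, modulate_apply, planeWave, planeWave,
    inner_smul_right]
  push_cast
  ring_nf

end Modulation

/-! ### First moments and the gain of derivatives. -/

section

variable {n : ℕ}

/-- The first absolute moment of a kernel. -/
def firstMoment (κ : 𝓢(Rn n, ℂ)) : ℝ≥0∞ := ∫⁻ y, ‖κ y‖ₑ * ‖y‖ₑ

theorem firstMoment_ne_top (κ : 𝓢(Rn n, ℂ)) : firstMoment κ ≠ ∞ := by
  have h := (SchwartzMap.integrable_pow_mul volume κ 1).2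
  rw [hasFiniteIntegral_iff_enorm] at h
  refine (lt_of_le_of_lt (lintegral_mono fun y => ?_) h).ne
  rw [enorm_mul, pow_one, enorm_norm, enorm_norm, mul_comm]

/-- This factor R⁻¹ produces both the decay R^{-M} in the far blocks and the N^{-1} in front of ∇f
in the lower bound. -/
theorem firstMoment_dilate {R : ℝ} (hR : 0 < R) (κ : 𝓢(Rn n, ℂ)) :
    firstMoment (dilate R κ) = ENNReal.ofReal R⁻¹ * firstMoment κ := by
  have hm : Measurable fun x : Rn n => R • x := measurable_const_smul R
  have h1 : ∀ y, ‖dilate R κ y‖ₑ * ‖y‖ₑ =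
      ENNReal.ofReal (R ^ n * R⁻¹) * (‖κ (R • y)‖ₑ * ‖R • y‖ₑ) := by
    intro y
    rw [dilate_apply hR, enorm_mul, enorm_smul, enorm_pow, ← ofReal_norm (R : ℂ), ← ofReal_norm R,
      Complex.norm_real, Real.norm_of_nonneg hR.le, ENNReal.ofReal_mul (by positivity),
      ENNReal.ofReal_pow hR.le, ENNReal.ofReal_inv_of_pos hR]
    have : (ENNReal.ofReal R)⁻¹ * ENNReal.ofReal R = 1 :=
      ENNReal.inv_mul_cancel (by simpa using hR) ENNReal.ofReal_ne_top
    calc _ = ENNReal.ofReal R ^ n * 1 * (‖κ (R • y)‖ₑ * ‖y‖ₑ) := by ring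
      _ = _ := by rw [← this]; ring
  have h2 : ∫⁻ y : Rn n, (‖κ (R • y)‖ₑ * ‖R • y‖ₑ) =
      ENNReal.ofReal ((R ^ n)⁻¹) * firstMoment κ := by
    have hmm : Measurable fun y : Rn n => ‖κ y‖ₑ * ‖y‖ₑ :=
      κ.continuous.enorm.measurable.mul measurable_enorm
    rw [← lintegral_map hmm hm, Measure.map_addHaar_smul _ hR.ne', lintegral_smul_measure]
    simp only [finrank_euclideanSpace, Fintype.card_fin]
    rw [abs_of_pos (by positivity)]
    rfl
  rw [firstMoment]
  simp only [h1]
  rw [lintegral_const_mul' _ _ ENNReal.ofReal_ne_top, h2, ← mul_assoc,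
    ← ENNReal.ofReal_mul (by positivity)]
  congr 2
  field_simp

section

variable {F : Type*} [NormedAddCommGroup F] [NormedSpace ℂ F] [CompleteSpace F]

/-- Fundamental theorem of calculus along the segment from x to x - y. -/
theorem enorm_sub_translate_le (g : 𝓢(Rn n, F)) (x y : Rn n) :
    ‖g (x - y) - g x‖ₑ ≤
      ∫⁻ t in Set.Ioc (0 : ℝ) 1, ‖y‖ₑ * ‖SchwartzMap.fderivCLM ℂ (Rn n) F g (x - t • y)‖ₑ := by
  have hd : ∀ t : ℝ, HasDerivAt (fun t : ℝ => g (x - t • y)) (fderiv ℝ g (x - t • y) (-y)) t := by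
    intro t
    have h1 : HasDerivAt (fun t : ℝ => x - t • y) (-y) t := by
      simpa using ((hasDerivAt_id t).smul_const y).const_sub x
    exact (g.hasFDerivAt _).comp_hasDerivAt t h1
  have hc : Continuous fun t : ℝ => fderiv ℝ g (x - t • y) (-y) := by
    have := (SchwartzMap.fderivCLM ℂ (Rn n) F g).continuous
    have h2 : Continuous fun t : ℝ => SchwartzMap.fderivCLM ℂ (Rn n) F g (x - t • y) :=
      this.comp (by fun_prop)
    exact h2.clm_apply continuous_const
  have hi := intervalIntegral.integral_eq_sub_of_hasDerivAt (a := 0) (b := 1)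
    (fun t _ => hd t) (hc.intervalIntegrable _ _)
  simp only [one_smul, zero_smul, sub_zero] at hi
  rw [← hi, intervalIntegral.integral_of_le zero_le_one]
  refine (enorm_integral_le_lintegral_enorm _).trans (lintegral_mono fun t => ?_)
  rw [mul_comm, ← enorm_neg y]
  exact ContinuousLinearMap.le_opENorm _ _

/-- Convolution with a kernel of integral `c` is multiplication by `c`, up to first derivatives. -/
theorem eLpNorm_schwartzConv_sub_le {p : ℝ≥0∞} (hp : 1 ≤ p) (κ : 𝓢(Rn n, ℂ)) (g : 𝓢(Rn n, F)) :
    eLpNorm (fun x => schwartzConv κ g x - (∫ y, κ y) • g x) p volume ≤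
      firstMoment κ * eLpNorm (SchwartzMap.fderivCLM ℂ (Rn n) F g) p volume := by
  have hw : Measurable fun z : Rn n × ℝ => ‖κ z.1‖ₑ * ‖z.1‖ₑ :=
    (κ.continuous.enorm.measurable.comp measurable_fst).mul measurable_fst.enorm
  have hwint : ∫⁻ z, ‖κ z.1‖ₑ * ‖z.1‖ₑ
      ∂((volume : Measure (Rn n)).prod (volume.restrict (Set.Ioc (0 : ℝ) 1))) =
      firstMoment κ := by
    rw [lintegral_prod _ hw.aemeasurable]
    simp [firstMoment]
  rw [← hwint]
  -- Minkowski is applied once on pairs (y, t), with weight |κ(y)||y| and shift t y, so the kernel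
  -- variable and the segment parameter are averaged together.
  refine eLpNorm_le_of_enorm_le_lintegral_mul_translate hp _ hw
    (by rw [hwint]; exact firstMoment_ne_top κ) (σ := fun z : Rn n × ℝ => z.2 • z.1)
    (measurable_snd.smul measurable_fst) (SchwartzMap.continuous _) fun x => ?_
  have h1 : schwartzConv κ g x - (∫ y, κ y) • g x = ∫ y, κ y • (g (x - y) - g x) := by
    rw [schwartzConv_apply, ← integral_smul_const, ← integral_sub (integrable_smul_translate κ g x)
      (κ.integrable.smul_const _)]
    simp only [smul_sub]
  have hm : Measurable fun z : Rn n × ℝ => ‖κ z.1‖ₑ * ‖z.1‖ₑ *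
      ‖SchwartzMap.fderivCLM ℂ (Rn n) F g (x - z.2 • z.1)‖ₑ := by
    refine hw.mul ?_
    exact ((SchwartzMap.continuous _).comp
      (continuous_const.sub (continuous_snd.smul continuous_fst))).enorm.measurable
  rw [h1, lintegral_prod _ hm.aemeasurable]
  refine (enorm_integral_le_lintegral_enorm _).trans (lintegral_mono fun y => ?_)
  rw [enorm_smul]
  refine (mul_le_mul_right (enorm_sub_translate_le g x y) _).trans_eq ?_
  rw [← lintegral_const_mul' _ _ enorm_ne_top]
  simp only [mul_assoc]

/-- The operator `g ↦ g - κ * g`. -/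
def convDefect (κ : 𝓢(Rn n, ℂ)) (g : 𝓢(Rn n, F)) : 𝓢(Rn n, F) := g - schwartzConv κ g

theorem fderivCLM_convDefect (κ : 𝓢(Rn n, ℂ)) (g : 𝓢(Rn n, F)) :
    SchwartzMap.fderivCLM ℂ (Rn n) F (convDefect κ g) =
      convDefect κ (SchwartzMap.fderivCLM ℂ (Rn n) F g) := by
  rw [convDefect, map_sub, fderivCLM_schwartzConv, convDefect]

theorem fderivCLM_iterate_convDefect (κ : 𝓢(Rn n, ℂ)) (M : ℕ) (g : 𝓢(Rn n, F)) :
    SchwartzMap.fderivCLM ℂ (Rn n) F ((convDefect κ)^[M] g) =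
      (convDefect κ)^[M] (SchwartzMap.fderivCLM ℂ (Rn n) F g) := by
  induction M with
  | zero => rfl
  | succ M ih => rw [Function.iterate_succ_apply', Function.iterate_succ_apply',
      fderivCLM_convDefect, ih]

theorem eLpNorm_convDefect_le {p : ℝ≥0∞} (hp : 1 ≤ p) {κ : 𝓢(Rn n, ℂ)} (hκ : ∫ y, κ y = 1)
    (g : 𝓢(Rn n, F)) :
    eLpNorm (convDefect κ g) p volume ≤
      firstMoment κ * eLpNorm (SchwartzMap.fderivCLM ℂ (Rn n) F g) p volume := by
  refine le_of_eq_of_le (eLpNorm_congr_norm_ae (Filter.Eventually.of_forall fun x => ?_))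
    (eLpNorm_schwartzConv_sub_le hp κ g)
  rw [hκ, one_smul, norm_sub_rev]
  rfl

end

/-- Iterating `g ↦ g - κ * g`, for a kernel of integral one, gains one derivative each time. -/
theorem eLpNorm_iterate_convDefect_le {p : ℝ≥0∞} (hp : 1 ≤ p) {κ : 𝓢(Rn n, ℂ)}
    (hκ : ∫ y, κ y = 1) (M : ℕ) : ∀ {F : Type} [NormedAddCommGroup F] [NormedSpace ℂ F]
    [CompleteSpace F] (g : 𝓢(Rn n, F)),
    eLpNorm ((convDefect κ)^[M] g) p volume ≤
      firstMoment κ ^ M * eLpNorm (iteratedFDeriv ℝ M (g : Rn n → F)) p volume := by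
  induction M with
  | zero =>
    intro F _ _ _ g
    refine le_of_eq ?_
    rw [pow_zero, one_mul]
    exact eLpNorm_congr_norm_ae (Filter.Eventually.of_forall fun x => by simp)
  | succ M ih =>
    intro F _ _ _ g
    rw [Function.iterate_succ_apply']
    refine (eLpNorm_convDefect_le hp hκ _).trans ?_
    -- The induction hypothesis is used for the derivative of g, whose values lie in another space;
    -- hence the quantification over F inside the induction.
    rw [fderivCLM_iterate_convDefect, pow_succ', mul_assoc]
    refine mul_le_mul_right ((ih _).trans_eq ?_) _
    congr 1
    refine eLpNorm_congr_norm_ae (Filter.Eventually.of_forall fun x => ?_)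
    exact norm_iteratedFDeriv_fderiv

end

/-! ### Reduction to Schwartz functions, and kernels localised in frequency. -/

section

variable {n : ℕ}

/-- The block's symbol is the Fourier transform of the dilated kernel, the factors 2π of the two
conventions cancelling. With `distLpNorm_coe`, this reduces the Besov norm to convolutions of
Schwartz functions. -/
theorem lpBlock_coe (φ₀ : 𝓢(Rn n, ℂ)) (j : ℤ) (f : 𝓢(Rn n, ℂ)) :
    lpBlock φ₀ j (f : 𝓢'(Rn n, ℂ)) =
      (schwartzConv (dilate ((2 : ℝ) ^ j) φ₀) f : 𝓢(Rn n, ℂ)) := by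
  have h := hasTemperateGrowth_lpBlock_symbol φ₀ j
  rw [lpBlock, TemperedDistribution.fourierMultiplierCLM_toTemperedDistributionCLM_eq h]
  congr 1
  refine schwartz_ext_fourier fun ξ => ?_
  rw [SchwartzMap.fourierMultiplierCLM_apply, FourierTransform.fourier_fourierInv_eq,
    SchwartzMap.smulLeftCLM_apply_apply h, fourier_schwartzConv, fourier_dilate (by positivity),
    dyadicSymbol, angularFourier, smul_comm _ (2 * Real.pi), inv_smul_smul₀ (by positivity),
    zpow_neg]

theorem distLpNorm_le {p : ℝ≥0∞} [Fact (1 ≤ p)] {u : 𝓢'(Rn n, ℂ)}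
    {g : Lp ℂ p (volume : Measure (Rn n))} (h : Lp.toTemperedDistribution g = u) :
    distLpNorm p u ≤ ‖g‖ₑ := by
  rw [distLpNorm]
  exact iInf₂_le g h

/-- `Lp` embeds injectively into tempered distributions, so the infimum runs over a single
representative. -/
theorem distLpNorm_coe (p : ℝ≥0∞) [Fact (1 ≤ p)] (f : 𝓢(Rn n, ℂ)) :
    distLpNorm p (f : 𝓢'(Rn n, ℂ)) = eLpNorm f p volume := by
  have hf : ‖f.toLp p‖ₑ = eLpNorm f p volume := by
    rw [Lp.enorm_def]
    exact eLpNorm_congr_ae (f.coeFn_toLp p)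
  have hcoe : Lp.toTemperedDistribution (f.toLp p) = (f : 𝓢'(Rn n, ℂ)) :=
    Lp.toTemperedDistribution_toLp_eq f
  refine le_antisymm ?_ ?_
  · rw [← hf]
    exact distLpNorm_le hcoe
  · refine le_iInf₂ fun g hg => ?_
    have hinj := LinearMap.ker_eq_bot.1
      (Lp.ker_toTemperedDistributionCLM_eq_bot (F := ℂ) (μ := (volume : Measure (Rn n))) (p := p))
    have : g = f.toLp p := hinj (hg.trans hcoe.symm)
    rw [this, hf]

theorem besovNorm_coe (φ₀ : 𝓢(Rn n, ℂ)) (s : ℝ) (p q : ℝ≥0∞) [Fact (1 ≤ p)] (f : 𝓢(Rn n, ℂ)) :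
    besovNorm φ₀ s p q (f : 𝓢'(Rn n, ℂ)) = lqNorm q fun j : ℤ =>
      ENNReal.ofReal ((2 : ℝ) ^ (s * j)) *
        eLpNorm (schwartzConv (dilate ((2 : ℝ) ^ j) φ₀) f) p volume := by
  simp only [besovNorm, lpBlock_coe, distLpNorm_coe]

theorem fourier_eq_angularFourier (κ : 𝓢(Rn n, ℂ)) (η : Rn n) :
    𝓕 κ η = angularFourier κ ((2 * Real.pi) • η) := by
  rw [angularFourier, inv_smul_smul₀ (by positivity)]

/-- A Schwartz kernel whose Fourier transform is a bump function. -/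
theorem exists_bump_kernel (c : Rn n) {δ : ℝ} (hδ : 0 < δ) :
    ∃ κ : 𝓢(Rn n, ℂ), angularFourier κ c = 1 ∧ ∀ ξ, δ ≤ ‖ξ - c‖ → angularFourier κ ξ = 0 := by
  have hπ := Real.pi_pos
  let b : ContDiffBump ((2 * Real.pi)⁻¹ • c) :=
    ⟨(2 * Real.pi)⁻¹ * (δ / 2), (2 * Real.pi)⁻¹ * δ, by positivity, by gcongr; linarith⟩
  have hcs : HasCompactSupport fun η => ((b η : ℝ) : ℂ) :=
    b.hasCompactSupport.comp_left (g := fun t : ℝ => (t : ℂ)) rfl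
  have hsm : ContDiff ℝ ((⊤ : ℕ∞) : WithTop ℕ∞) fun η => ((b η : ℝ) : ℂ) :=
    Complex.ofRealCLM.contDiff.comp b.contDiff
  refine ⟨𝓕⁻ (hcs.toSchwartzMap hsm), ?_, fun ξ hξ => ?_⟩
  · rw [angularFourier, FourierTransform.fourier_fourierInv_eq]
    have : b ((2 * Real.pi)⁻¹ • c) = 1 :=
      b.one_of_mem_closedBall (Metric.mem_closedBall_self b.rIn_pos.le)
    exact (congrArg Complex.ofReal this).trans Complex.ofReal_one
  · rw [angularFourier, FourierTransform.fourier_fourierInv_eq]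
    have : b ((2 * Real.pi)⁻¹ • ξ) = 0 := by
      refine b.zero_of_le_dist ?_
      rw [dist_eq_norm, ← smul_sub, norm_smul, Real.norm_of_nonneg (by positivity)]
      exact mul_le_mul_of_nonneg_left hξ (by positivity)
    exact (congrArg Complex.ofReal this).trans Complex.ofReal_zero

theorem IsLittlewoodPaley.eq_zero {φ₀ : 𝓢(Rn n, ℂ)} (hφ₀ : IsLittlewoodPaley φ₀) {ξ : Rn n}
    (hξ : ‖ξ‖ < 2⁻¹ ∨ 2 < ‖ξ‖) : angularFourier φ₀ ξ = 0 := by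
  by_contra h
  obtain ⟨h1, h2⟩ := hφ₀.supp (subset_tsupport _ h)
  rcases hξ with hξ | hξ <;> linarith

/-- The spectra are disjoint, so φ * κ = 0 and the correction κ * g subtracted at each iteration is
invisible to φ. -/
theorem schwartzConv_iterate_convDefect {φ κ : 𝓢(Rn n, ℂ)} (h : ∀ η, 𝓕 φ η * 𝓕 κ η = 0)
    (M : ℕ) (f : 𝓢(Rn n, ℂ)) :
    schwartzConv φ ((convDefect κ)^[M] f) = schwartzConv φ f := by
  induction M with
  | zero => rfl
  | succ M ih =>
    rw [Function.iterate_succ_apply', convDefect, map_sub, ih, sub_eq_self]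
    refine schwartz_ext_fourier fun η => ?_
    rw [fourier_schwartzConv, fourier_schwartzConv, smul_smul, h, zero_smul,
      FourierTransform.fourier_zero]
    rfl

/-- If the kernel `φ`, seen from the frequency `r a`, lives away from the ball of radius `R`, then
convolving a modulated amplitude with `φ` only sees `M`-th derivatives of the amplitude. -/
theorem eLpNorm_schwartzConv_modulate_le {p p' p'' : ℝ≥0∞} (hp' : 1 ≤ p')
    {κ φ : 𝓢(Rn n, ℂ)}
    (hκ1 : angularFourier κ 0 = 1) (hκ0 : ∀ ξ, 1 ≤ ‖ξ‖ → angularFourier κ ξ = 0)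
    (hA : ∀ ψ g : 𝓢(Rn n, ℂ), eLpNorm (schwartzConv ψ g) p volume ≤
      eLpNorm ψ p'' volume * eLpNorm g p' volume)
    {R : ℝ} (hR : 0 < R) (r : ℝ) (a : Rn n)
    (hφ : ∀ ξ, ‖ξ‖ < R → angularFourier φ (ξ + r • a) = 0) (M : ℕ) (f : 𝓢(Rn n, ℂ)) :
    eLpNorm (schwartzConv φ (modulate r a f)) p volume ≤
      eLpNorm φ p'' volume * ((ENNReal.ofReal R⁻¹ * firstMoment κ) ^ M * gradLpNorm M p' f) := by
  have hκi : ∫ y, dilate R κ y = 1 := by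
    have h := fourier_dilate hR κ 0
    rw [SchwartzMap.fourier_coe, Real.fourier_eq', smul_zero, fourier_eq_angularFourier, smul_zero,
      hκ1] at h
    simpa using h
  -- Inside the ball of radius R the recentred φ vanishes; outside it the dilated κ does.
  have hz : ∀ η, 𝓕 (modulate (-r) a φ) η * 𝓕 (dilate R κ) η = 0 := by
    intro η
    rw [fourier_modulate, fourier_dilate hR, fourier_eq_angularFourier, fourier_eq_angularFourier κ]
    rcases lt_or_ge ‖(2 * Real.pi) • η‖ R with h | h
    · rw [show (2 * Real.pi) • (η - ((2 * Real.pi)⁻¹ * -r) • a) = (2 * Real.pi) • η + r • a by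
        rw [smul_sub, smul_smul, mul_inv_cancel_left₀ (by positivity), neg_smul, sub_neg_eq_add],
        hφ _ h, zero_mul]
    · rw [hκ0, mul_zero]
      rw [smul_comm, norm_smul, Real.norm_of_nonneg (by positivity), inv_mul_eq_div,
        one_le_div hR]
      exact h
  rw [schwartzConv_modulate, eLpNorm_modulate, ← schwartzConv_iterate_convDefect hz M]
  refine (hA _ _).trans ?_
  rw [eLpNorm_modulate, ← firstMoment_dilate hR]
  exact mul_le_mul_right (eLpNorm_iterate_convDefect_le hp' hκi M f) _

end

/-! ### Decay of blocks far from the carrier. -/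

section

variable {n : ℕ}

theorem angularFourier_dilate {R : ℝ} (hR : 0 < R) (κ : 𝓢(Rn n, ℂ)) (ξ : Rn n) :
    angularFourier (dilate R κ) ξ = angularFourier κ (R⁻¹ • ξ) := by
  rw [angularFourier, angularFourier, fourier_dilate hR, smul_comm]

/-- Littlewood-Paley pieces far from the frequency `2^i` of the carrier vanish near the origin of
the frequency space of the amplitude. -/
theorem IsLittlewoodPaley.dilate_eq_zero {φ₀ : 𝓢(Rn n, ℂ)} (hφ₀ : IsLittlewoodPaley φ₀)
    {i j : ℤ} (hij : 3 ≤ |j - i|) {a : Rn n} (ha : ‖a‖ = 1) {ξ : Rn n}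
    (hξ : ‖ξ‖ < (2 : ℝ) ^ (max i j - 2)) :
    angularFourier (dilate ((2 : ℝ) ^ j) φ₀) (ξ + ((2 : ℝ) ^ i) • a) = 0 := by
  have hj : (0 : ℝ) < 2 ^ j := by positivity
  have hna : ‖((2 : ℝ) ^ i) • a‖ = 2 ^ i := by
    rw [norm_smul, ha, mul_one, Real.norm_of_nonneg (by positivity)]
  rw [angularFourier_dilate hj]
  refine hφ₀.eq_zero ?_
  rw [norm_smul, norm_inv, Real.norm_of_nonneg hj.le, inv_mul_lt_iff₀ hj, lt_inv_mul_iff₀ hj]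
  have h2 : ∀ m : ℤ, (2 : ℝ) ^ m = 2 ^ (m - 2) * 4 := fun m => by
    rw [zpow_sub₀ two_ne_zero]; norm_num
  have h3 : ∀ m : ℤ, (2 : ℝ) ^ m = 2 ^ (m - 3) * 8 := fun m => by
    rw [zpow_sub₀ two_ne_zero]; norm_num
  rcases le_abs.1 hij with h | h
  · left
    rw [max_eq_right (by omega)] at hξ
    have h4 : (2 : ℝ) ^ i ≤ 2 ^ (j - 3) := zpow_le_zpow_right₀ one_le_two (by omega)
    have := norm_add_le ξ (((2 : ℝ) ^ i) • a)
    rw [hna] at this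
    linarith [h2 j, h3 j]
  · right
    rw [max_eq_left (by omega)] at hξ
    have h4 : (2 : ℝ) ^ j ≤ 2 ^ (i - 3) := zpow_le_zpow_right₀ one_le_two (by omega)
    have := norm_sub_le (ξ + ((2 : ℝ) ^ i) • a) ξ
    rw [add_sub_cancel_left, hna] at this
    linarith [h2 i, h3 i]

theorem tsum_two_rpow_neg_abs_ne_top {δ : ℝ} (hδ : 0 < δ) :
    ∑' d : ℤ, ENNReal.ofReal ((2 : ℝ) ^ (-δ * |(d : ℝ)|)) ≠ ∞ := by
  have hs : Summable fun k : ℕ => (2 : ℝ) ^ (-δ * (k : ℝ)) := by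
    have h1 : (2 : ℝ) ^ (-δ) < 1 := Real.rpow_lt_one_of_one_lt_of_neg one_lt_two (by linarith)
    refine (summable_geometric_of_lt_one (by positivity) h1).congr fun k => ?_
    rw [Real.rpow_mul zero_le_two, Real.rpow_natCast]
  have : Summable fun d : ℤ => (2 : ℝ) ^ (-δ * |(d : ℝ)|) :=
    Summable.of_nat_of_neg (by simpa using hs) (by simpa using hs)
  exact this.tsum_ofReal_ne_top

/-- Decay of the Littlewood-Paley pieces of a modulated amplitude away from the carrier frequency. -/
theorem exists_far_bound {φ₀ : 𝓢(Rn n, ℂ)} (hφ₀ : IsLittlewoodPaley φ₀)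
    (p : ℝ≥0∞) (hp : 1 ≤ p) (s : ℝ) (hs : (n : ℝ) * (p⁻¹).toReal - n < s) (M : ℕ) (hMs : s < M) :
    ∃ w : ℤ → ℝ≥0∞, (∑' d, w d) ≠ ∞ ∧ ∀ (i : ℕ) (j : ℤ), 3 ≤ |j - i| → ∀ a : Rn n, ‖a‖ = 1 →
      ∀ f : 𝓢(Rn n, ℂ),
        ENNReal.ofReal ((2 : ℝ) ^ (s * j)) *
          eLpNorm (schwartzConv (dilate ((2 : ℝ) ^ j) φ₀) (modulate (2 ^ i) a f)) p volume ≤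
        w (j - i) * (ENNReal.ofReal (((2 : ℝ) ^ i) ^ (s + n * (1 - (p⁻¹).toReal) - M)) *
          gradLpL1Norm M p f) := by
  obtain ⟨κ, hκ1, hκ0⟩ := exists_bump_kernel (0 : Rn n) one_pos
  simp only [sub_zero] at hκ0
  set ν : ℝ := n * (1 - (p⁻¹).toReal) with hν
  have hν0 : 0 ≤ ν := by
    have : (p⁻¹).toReal ≤ 1 := by
      rw [← ENNReal.toReal_one]
      exact ENNReal.toReal_mono ENNReal.one_ne_top (ENNReal.inv_le_one.2 hp)
    have : 0 ≤ 1 - (p⁻¹).toReal := by linarith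
    positivity
  have hsν : 0 < s + ν := by rw [hν]; linarith
  -- M - s is the decay rate for blocks above the carrier, s + ν the rate below it.
  set δ : ℝ := min (M - s) (s + ν) with hδ
  have hδ0 : 0 < δ := lt_min (by linarith) hsν
  -- The 4 is the 2² lost in the radius 2^{max(i,j)-2}.
  set m : ℝ≥0∞ := (4 * firstMoment κ) ^ M with hm
  have hmt : m ≠ ∞ := ENNReal.pow_ne_top (ENNReal.mul_ne_top (by simp) (firstMoment_ne_top κ))
  set A : ℝ≥0∞ := m * (eLpNorm φ₀ 1 volume + eLpNorm φ₀ p volume) with hA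
  have hAt : A ≠ ∞ := ENNReal.mul_ne_top hmt (ENNReal.add_ne_top.2
    ⟨(φ₀.memLp 1 volume).eLpNorm_ne_top, (φ₀.memLp p volume).eLpNorm_ne_top⟩)
  have hA1 : m * eLpNorm φ₀ 1 volume ≤ A := mul_le_mul_right le_self_add _
  have hA2 : m * eLpNorm φ₀ p volume ≤ A := mul_le_mul_right le_add_self _
  refine ⟨fun d => A * ENNReal.ofReal ((2 : ℝ) ^ (-δ * |(d : ℝ)|)), ?_, ?_⟩
  · rw [ENNReal.tsum_mul_left]
    exact ENNReal.mul_ne_top hAt (tsum_two_rpow_neg_abs_ne_top hδ0)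
  intro i j hij a ha f
  have hR : (0 : ℝ) < 2 ^ (max (i : ℤ) j - 2) := by positivity
  have hsup : ∀ ξ : Rn n, ‖ξ‖ < (2 : ℝ) ^ (max (i : ℤ) j - 2) →
      angularFourier (dilate ((2 : ℝ) ^ j) φ₀) (ξ + ((2 : ℝ) ^ i) • a) = 0 := by
    intro ξ hξ
    have := hφ₀.dilate_eq_zero hij ha hξ
    rwa [zpow_natCast] at this
  have hj : (0 : ℝ) < 2 ^ j := by positivity
  have hpow : (ENNReal.ofReal ((2 : ℝ) ^ (max (i : ℤ) j - 2))⁻¹ * firstMoment κ) ^ M =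
      m * ENNReal.ofReal ((2 : ℝ) ^ (-(M : ℝ) * (max (i : ℤ) j : ℤ))) := by
    have e1 : ((2 : ℝ) ^ (max (i : ℤ) j - 2))⁻¹ = 4 * (2 : ℝ) ^ (-((max (i : ℤ) j : ℤ) : ℝ)) := by
      rw [zpow_sub₀ two_ne_zero, Real.rpow_neg zero_le_two, Real.rpow_intCast]
      field_simp
      norm_num
    rw [e1, ENNReal.ofReal_mul (by norm_num), hm,
      show -(M : ℝ) * (max (i : ℤ) j : ℤ) = -((max (i : ℤ) j : ℤ) : ℝ) * M by ring,
      Real.rpow_mul zero_le_two, Real.rpow_natCast, ENNReal.ofReal_pow (by positivity), ← mul_pow]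
    congr 1
    rw [show ENNReal.ofReal 4 = 4 by norm_num]
    ring
  have hip : ((2 : ℝ) ^ i) ^ (s + ν - M) = 2 ^ ((i : ℝ) * (s + ν - M)) := by
    rw [Real.rpow_mul zero_le_two, Real.rpow_natCast]
  rw [hip]
  rcases le_abs.1 hij with h | h
  -- Above the carrier the kernel is measured in L¹, which is dilation invariant; the factor 2^{-Mj}
  -- beats 2^{sj}.
  · have key := eLpNorm_schwartzConv_modulate_le (p := p) (p'' := 1) hp hκ1 hκ0
      (fun ψ g => eLpNorm_schwartzConv_le hp ψ g) hR _ a hsup M f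
    rw [hpow, eLpNorm_one_dilate hj] at key
    have hexp : ENNReal.ofReal ((2 : ℝ) ^ (s * j)) *
        ENNReal.ofReal ((2 : ℝ) ^ (-(M : ℝ) * (max (i : ℤ) j : ℤ))) ≤
        ENNReal.ofReal ((2 : ℝ) ^ (-δ * |((j - i : ℤ) : ℝ)|)) *
          ENNReal.ofReal ((2 : ℝ) ^ ((i : ℝ) * (s + ν - M))) := by
      rw [← ENNReal.ofReal_mul (by positivity), ← ENNReal.ofReal_mul (by positivity),
        ← Real.rpow_add two_pos, ← Real.rpow_add two_pos]
      refine ENNReal.ofReal_le_ofReal (Real.rpow_le_rpow_of_exponent_le one_le_two ?_)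
      have h3 : (0 : ℝ) ≤ ((j - i : ℤ) : ℝ) := by exact_mod_cast (by omega : (0 : ℤ) ≤ j - i)
      rw [max_eq_right (by omega), abs_of_nonneg h3]
      push_cast at h3 ⊢
      have h4 : δ * ((j : ℝ) - i) ≤ (M - s) * (j - i) :=
        mul_le_mul_of_nonneg_right (min_le_left _ _) h3
      have h5 : (0 : ℝ) ≤ i * ν := by positivity
      nlinarith
    calc _ ≤ ENNReal.ofReal ((2 : ℝ) ^ (s * j)) * (eLpNorm φ₀ 1 volume *
          (m * ENNReal.ofReal ((2 : ℝ) ^ (-(M : ℝ) * (max (i : ℤ) j : ℤ))) *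
            gradLpNorm M p f)) := mul_le_mul_right key _
      _ = (m * eLpNorm φ₀ 1 volume) * (ENNReal.ofReal ((2 : ℝ) ^ (s * j)) *
          ENNReal.ofReal ((2 : ℝ) ^ (-(M : ℝ) * (max (i : ℤ) j : ℤ)))) * gradLpNorm M p f := by
          ring
      _ ≤ A * (ENNReal.ofReal ((2 : ℝ) ^ (-δ * |((j - i : ℤ) : ℝ)|)) *
          ENNReal.ofReal ((2 : ℝ) ^ ((i : ℝ) * (s + ν - M)))) * gradLpL1Norm M p f := by
          gcongr
          · exact le_self_add
      _ = _ := by ring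
  -- Below the carrier R^{-M} no longer depends on j; the decay comes from the small L^p norm 2^{jν}
  -- of the kernel.
  · have key := eLpNorm_schwartzConv_modulate_le (p := p) (p'' := p) le_rfl hκ1 hκ0
      (fun ψ g => eLpNorm_schwartzConv_le' hp ψ g) hR _ a hsup M f
    rw [hpow, eLpNorm_dilate hj hp, ← hν] at key
    have hexp : ENNReal.ofReal ((2 : ℝ) ^ (s * j)) * (ENNReal.ofReal (((2 : ℝ) ^ j) ^ ν) *
        ENNReal.ofReal ((2 : ℝ) ^ (-(M : ℝ) * (max (i : ℤ) j : ℤ)))) ≤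
        ENNReal.ofReal ((2 : ℝ) ^ (-δ * |((j - i : ℤ) : ℝ)|)) *
          ENNReal.ofReal ((2 : ℝ) ^ ((i : ℝ) * (s + ν - M))) := by
      rw [← Real.rpow_intCast, ← Real.rpow_mul zero_le_two, ← ENNReal.ofReal_mul (by positivity),
        ← ENNReal.ofReal_mul (by positivity), ← ENNReal.ofReal_mul (by positivity),
        ← Real.rpow_add two_pos, ← Real.rpow_add two_pos, ← Real.rpow_add two_pos]
      refine ENNReal.ofReal_le_ofReal (Real.rpow_le_rpow_of_exponent_le one_le_two ?_)
      have h3 : ((j - i : ℤ) : ℝ) ≤ 0 := by exact_mod_cast (by omega : j - i ≤ (0 : ℤ))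
      rw [max_eq_left (by omega), abs_of_nonpos h3]
      push_cast at h3 ⊢
      have h4 : δ * ((i : ℝ) - j) ≤ (s + ν) * (i - j) :=
        mul_le_mul_of_nonneg_right (min_le_right _ _) (by linarith)
      nlinarith
    calc _ ≤ ENNReal.ofReal ((2 : ℝ) ^ (s * j)) * (ENNReal.ofReal (((2 : ℝ) ^ j) ^ ν) *
          eLpNorm φ₀ p volume *
          (m * ENNReal.ofReal ((2 : ℝ) ^ (-(M : ℝ) * (max (i : ℤ) j : ℤ))) *
            gradLpNorm M 1 f)) := mul_le_mul_right key _
      _ = (m * eLpNorm φ₀ p volume) * (ENNReal.ofReal ((2 : ℝ) ^ (s * j)) *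
          (ENNReal.ofReal (((2 : ℝ) ^ j) ^ ν) *
          ENNReal.ofReal ((2 : ℝ) ^ (-(M : ℝ) * (max (i : ℤ) j : ℤ))))) * gradLpNorm M 1 f := by
          ring
      _ ≤ A * (ENNReal.ofReal ((2 : ℝ) ^ (-δ * |((j - i : ℤ) : ℝ)|)) *
          ENNReal.ofReal ((2 : ℝ) ^ ((i : ℝ) * (s + ν - M)))) * gradLpL1Norm M p f := by
          gcongr
          · exact le_add_self
      _ = _ := by ring

end

/-! ### Inequalities for ℓ^q norms in [0, ∞]. -/

section SequenceNorm

variable {ι ι' : Type*} {q : ℝ≥0∞}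

theorem lqNorm_mono {a b : ι → ℝ≥0∞} (h : ∀ i, a i ≤ b i) : lqNorm q a ≤ lqNorm q b := by
  rw [lqNorm, lqNorm]
  split_ifs
  · exact iSup_mono h
  · gcongr with i
    exact h i

theorem lqNorm_add_le (hq : 1 ≤ q) (a b : ι → ℝ≥0∞) :
    lqNorm q (fun i => a i + b i) ≤ lqNorm q a + lqNorm q b := by
  rw [lqNorm, lqNorm, lqNorm]
  split_ifs with h
  · exact iSup_le fun i => add_le_add (le_iSup a i) (le_iSup b i)
  · have hr : 1 ≤ q.toReal := by
      rw [← ENNReal.toReal_one]; exact ENNReal.toReal_mono h hq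
    rw [ENNReal.rpow_inv_le_iff (by linarith), ENNReal.tsum_eq_iSup_sum]
    refine iSup_le fun t => ?_
    rw [← ENNReal.rpow_inv_le_iff (by linarith), ← one_div]
    refine (ENNReal.Lp_add_le t a b hr).trans ?_
    gcongr <;> exact ENNReal.sum_le_tsum t

theorem lqNorm_zero (hq : 1 ≤ q) : lqNorm q (fun _ : ι => 0) = 0 := by
  rw [lqNorm]
  split_ifs with h
  · simp
  · have hr : 0 < q.toReal := ENNReal.toReal_pos (zero_lt_one.trans_le hq).ne' h
    simp [hr]

theorem lqNorm_sum_le (hq : 1 ≤ q) {κ : Type*} (t : Finset κ) (a : κ → ι → ℝ≥0∞) :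
    lqNorm q (fun i => ∑ k ∈ t, a k i) ≤ ∑ k ∈ t, lqNorm q (a k) := by
  classical
  induction t using Finset.induction_on with
  | empty => simp [lqNorm_zero hq]
  | insert k t hk ih =>
    simp only [Finset.sum_insert hk]
    exact (lqNorm_add_le hq _ _).trans (add_le_add le_rfl ih)

theorem lqNorm_const_mul (hq : 1 ≤ q) (c : ℝ≥0∞) (a : ι → ℝ≥0∞) :
    lqNorm q (fun i => c * a i) = c * lqNorm q a := by
  rw [lqNorm, lqNorm]
  split_ifs with h
  · rw [ENNReal.mul_iSup]
  · have hr : 0 < q.toReal := ENNReal.toReal_pos (zero_lt_one.trans_le hq).ne' h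
    simp only [ENNReal.mul_rpow_of_nonneg _ _ hr.le]
    rw [ENNReal.tsum_mul_left, ENNReal.mul_rpow_of_nonneg _ _ (by positivity),
      ENNReal.rpow_rpow_inv hr.ne']

theorem lqNorm_comp_le {e : ι → ι'} (he : Function.Injective e) (a : ι' → ℝ≥0∞) :
    lqNorm q (fun i => a (e i)) ≤ lqNorm q a := by
  rw [lqNorm, lqNorm]
  split_ifs
  · exact iSup_le fun i => le_iSup a (e i)
  · gcongr
    exact ENNReal.tsum_comp_le_tsum_of_injective he fun i => a i ^ q.toReal

theorem lqNorm_le_lqNorm_comp (hq : 1 ≤ q) {e : ι → ι'} (he : Function.Injective e)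
    {a : ι' → ℝ≥0∞} (ha : ∀ j, j ∉ Set.range e → a j = 0) :
    lqNorm q a ≤ lqNorm q (fun i => a (e i)) := by
  rw [lqNorm, lqNorm]
  split_ifs with h
  · refine iSup_le fun j => ?_
    by_cases hj : j ∈ Set.range e
    · obtain ⟨i, rfl⟩ := hj
      exact le_iSup (fun i => a (e i)) i
    · simp [ha j hj]
  · have hr : 0 < q.toReal := ENNReal.toReal_pos (zero_lt_one.trans_le hq).ne' h
    refine le_of_eq ?_
    congr 1
    refine (he.tsum_eq fun j hj => ?_).symm
    by_contra hj'
    exact hj (by simp [ha j hj', hr])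

/-- Placing a finite family at distinct positions preserves its `ℓ^q` norm. -/
theorem lqNorm_sum_ite_le [Fintype ι] [DecidableEq ι'] (hq : 1 ≤ q) {e : ι → ι'}
    (he : Function.Injective e) (a : ι → ℝ≥0∞) :
    lqNorm q (fun j => ∑ i, if e i = j then a i else 0) ≤ lqNorm q a := by
  classical
  refine (lqNorm_le_lqNorm_comp hq he fun j hj => ?_).trans (lqNorm_mono fun i => ?_)
  · exact Finset.sum_eq_zero fun i _ => if_neg fun h => hj ⟨i, h⟩
  · simp [he.eq_iff]

/-- With T the total sum, x^q = x · x^{q-1} ≤ x · T^{q-1} for each term x; summing gives T^q. Error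
terms are estimated this way, so their form does not depend on q. -/
theorem lqNorm_le_tsum (hq : 1 ≤ q) (a : ι → ℝ≥0∞) : lqNorm q a ≤ ∑' i, a i := by
  rw [lqNorm]
  split_ifs with h
  · exact iSup_le fun i => ENNReal.le_tsum i
  · have hr : 1 ≤ q.toReal := by
      rw [← ENNReal.toReal_one]; exact ENNReal.toReal_mono h hq
    have hsplit : ∀ x : ℝ≥0∞, x ^ q.toReal = x * x ^ (q.toReal - 1) := fun x => by
      nth_rewrite 2 [← ENNReal.rpow_one x]
      rw [← ENNReal.rpow_add_of_nonneg _ _ zero_le_one (by linarith), add_sub_cancel]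
    rw [ENNReal.rpow_inv_le_iff (by linarith), hsplit (∑' i, a i), ← ENNReal.tsum_mul_right]
    refine ENNReal.tsum_le_tsum fun i => ?_
    rw [hsplit]
    gcongr
    exact ENNReal.le_tsum i

end SequenceNorm

/-! ### Elementary norm identities for amplitudes. -/

section SchwartzNorm

variable {n : ℕ} {p : ℝ≥0∞}

theorem eLpNorm_schwartz_add_le (hp : 1 ≤ p) (f g : 𝓢(Rn n, ℂ)) :
    eLpNorm (f + g : 𝓢(Rn n, ℂ)) p volume ≤ eLpNorm f p volume + eLpNorm g p volume :=
  eLpNorm_add_le f.continuous.aestronglyMeasurable g.continuous.aestronglyMeasurable hp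

theorem eLpNorm_schwartz_sub_le (hp : 1 ≤ p) (f g : 𝓢(Rn n, ℂ)) :
    eLpNorm (f - g : 𝓢(Rn n, ℂ)) p volume ≤ eLpNorm f p volume + eLpNorm g p volume :=
  eLpNorm_sub_le f.continuous.aestronglyMeasurable g.continuous.aestronglyMeasurable hp

theorem eLpNorm_schwartz_smul (c : ℂ) (f : 𝓢(Rn n, ℂ)) :
    eLpNorm (c • f : 𝓢(Rn n, ℂ)) p volume = ‖c‖ₑ * eLpNorm f p volume :=
  eLpNorm_const_smul c f p volume

theorem eLpNorm_schwartz_sum_le (hp : 1 ≤ p) {ι : Type*} (t : Finset ι) (f : ι → 𝓢(Rn n, ℂ)) :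
    eLpNorm (∑ i ∈ t, f i : 𝓢(Rn n, ℂ)) p volume ≤ ∑ i ∈ t, eLpNorm (f i) p volume := by
  classical
  induction t using Finset.induction_on with
  | empty =>
    refine le_of_eq ?_
    rw [Finset.sum_empty, Finset.sum_empty]
    exact eLpNorm_zero
  | insert i t hi ih =>
    rw [Finset.sum_insert hi, Finset.sum_insert hi]
    exact (eLpNorm_schwartz_add_le hp _ _).trans (add_le_add le_rfl ih)

theorem gradLpNorm_one (f : 𝓢(Rn n, ℂ)) :
    gradLpNorm 1 p f = eLpNorm (SchwartzMap.fderivCLM ℂ (Rn n) ℂ f) p volume := by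
  refine eLpNorm_congr_norm_ae (Filter.Eventually.of_forall fun x => ?_)
  rw [norm_iteratedFDeriv_one]
  rfl

theorem firstMoment_modulate (r : ℝ) (a : Rn n) (κ : 𝓢(Rn n, ℂ)) :
    firstMoment (modulate r a κ) = firstMoment κ := by
  simp only [firstMoment, modulate_apply, enorm_mul, ← ofReal_norm (planeWave _ _ _),
    norm_planeWave, ENNReal.ofReal_one, one_mul]

end SchwartzNorm

/-! ### The upper bound. -/

section

variable {n : ℕ}

theorem oscSum_eq {K : ℕ} (a : Fin K → Rn n) (L : ℕ) (lam : ℝ) (b : ℕ → ℂ)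
    (f : Fin K → 𝓢(Rn n, ℂ)) :
    oscSum a L lam b f = ∑ l : Finset.Icc 1 L, ∑ k : Fin K,
      b l • modulate (lam ^ (l : ℕ)) (a k) (f k) := by
  rw [oscSum, Finset.sum_comm, ← Finset.sum_coe_sort]
  rfl

theorem ofReal_rpow_mul_norm {lam : ℝ} (hlam : 0 < lam) (x : ℝ) (l : ℕ) (z : ℂ) :
    ENNReal.ofReal (lam ^ (x * l) * ‖z‖) = ENNReal.ofReal ((lam ^ l) ^ x) * ‖z‖ₑ := by
  rw [ENNReal.ofReal_mul (by positivity), ofReal_norm, mul_comm x, Real.rpow_mul hlam.le,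
    Real.rpow_natCast]

/-- The weighted `L^p` norm `2^{sj} ‖Δⱼ f‖_{L^p}`. -/
def blockNorm (φ₀ : 𝓢(Rn n, ℂ)) (s : ℝ) (p : ℝ≥0∞) (j : ℤ) (f : 𝓢(Rn n, ℂ)) : ℝ≥0∞ :=
  ENNReal.ofReal ((2 : ℝ) ^ (s * j)) *
    eLpNorm (schwartzConv (dilate ((2 : ℝ) ^ j) φ₀) f) p volume

theorem blockNorm_sum_smul_le {φ₀ : 𝓢(Rn n, ℂ)} {s : ℝ} {p : ℝ≥0∞} (hp : 1 ≤ p) {j : ℤ}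
    {ι : Type*} (t : Finset ι) (c : ι → ℂ) (f : ι → 𝓢(Rn n, ℂ)) :
    blockNorm φ₀ s p j (∑ i ∈ t, c i • f i) ≤ ∑ i ∈ t, ‖c i‖ₑ * blockNorm φ₀ s p j (f i) := by
  rw [blockNorm, map_sum]
  refine (mul_le_mul_right (eLpNorm_schwartz_sum_le hp _ _) _).trans_eq ?_
  rw [Finset.mul_sum]
  refine Finset.sum_congr rfl fun i _ => ?_
  rw [map_smul, eLpNorm_schwartz_smul, blockNorm]
  ring

theorem blockNorm_oscSum_le {φ₀ : 𝓢(Rn n, ℂ)} {s : ℝ} {p : ℝ≥0∞} (hp : 1 ≤ p) {j : ℤ}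
    {ι κ : Type*} (t : Finset ι) (u : Finset κ) (c : ι → ℂ) (f : ι → κ → 𝓢(Rn n, ℂ)) :
    blockNorm φ₀ s p j (∑ i ∈ t, ∑ k ∈ u, c i • f i k) ≤
      ∑ i ∈ t, ‖c i‖ₑ * ∑ k ∈ u, blockNorm φ₀ s p j (f i k) := by
  rw [← Finset.sum_product']
  refine (blockNorm_sum_smul_le hp _ _ _).trans_eq ?_
  rw [Finset.sum_product]
  simp only [Finset.mul_sum]

/-- The contribution of all far Littlewood-Paley pieces, up to a constant. -/
def farSum (s : ℝ) (p : ℝ≥0∞) (M L : ℕ) (lam : ℝ) {K : ℕ} (b : ℕ → ℂ)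
    (f : Fin K → 𝓢(Rn n, ℂ)) : ℝ≥0∞ :=
  ∑ k : Fin K, ∑ l ∈ Finset.Icc 1 L,
    ENNReal.ofReal (lam ^ ((s + n * (1 - (p⁻¹).toReal) - M) * l) * ‖b l‖) * gradLpL1Norm M p (f k)

theorem farSum_eq (s : ℝ) (p : ℝ≥0∞) (M L : ℕ) {lam : ℝ} (hlam : 0 < lam) {K : ℕ} (b : ℕ → ℂ)
    (f : Fin K → 𝓢(Rn n, ℂ)) :
    farSum s p M L lam b f = ∑ l : Finset.Icc 1 L, ‖b l‖ₑ * ∑ k : Fin K,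
      ENNReal.ofReal ((lam ^ (l : ℕ)) ^ (s + n * (1 - (p⁻¹).toReal) - M)) *
        gradLpL1Norm M p (f k) := by
  rw [farSum, Finset.sum_comm, ← Finset.sum_coe_sort]
  refine Finset.sum_congr rfl fun l _ => ?_
  rw [Finset.mul_sum]
  refine Finset.sum_congr rfl fun k _ => ?_
  rw [ofReal_rpow_mul_norm hlam]
  ring

theorem blockNorm_modulate_le {φ₀ : 𝓢(Rn n, ℂ)} {s : ℝ} {p : ℝ≥0∞} (hp : 1 ≤ p) (i : ℕ) (r : ℤ)
    (a : Rn n) (f : 𝓢(Rn n, ℂ)) :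
    blockNorm φ₀ s p (i + r) (modulate (2 ^ i) a f) ≤
      ENNReal.ofReal ((2 : ℝ) ^ (s * r)) * eLpNorm φ₀ 1 volume *
        (ENNReal.ofReal (((2 : ℝ) ^ i) ^ s) * eLpNorm f p volume) := by
  have h := eLpNorm_schwartzConv_le hp (dilate ((2 : ℝ) ^ ((i : ℤ) + r)) φ₀) (modulate (2 ^ i) a f)
  rw [eLpNorm_one_dilate (by positivity), eLpNorm_modulate] at h
  have hw : ENNReal.ofReal ((2 : ℝ) ^ (s * ((i + r : ℤ) : ℝ))) =
      ENNReal.ofReal ((2 : ℝ) ^ (s * r)) * ENNReal.ofReal (((2 : ℝ) ^ i) ^ s) := by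
    rw [← ENNReal.ofReal_mul (by positivity), ← Real.rpow_natCast, ← Real.rpow_mul zero_le_two,
      ← Real.rpow_add two_pos]
    congr 2
    push_cast
    ring
  rw [blockNorm, hw]
  refine (mul_le_mul_right h _).trans_eq ?_
  ring

theorem tsum_shift_eq (w : ℤ → ℝ≥0∞) (i : ℤ) : ∑' j, w (j - i) = ∑' j, w j :=
  (Equiv.subRight i).tsum_eq w

/-- Near blocks are summed in ℓ^q by disjointness of their positions, far blocks in ℓ¹ by the
summable weight w. The directions enter only through |a_k| = 1, so the constant is uniform in them.
-/
theorem exists_upper_bound {φ₀ : 𝓢(Rn n, ℂ)} (hφ₀ : IsLittlewoodPaley φ₀)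
    (p q : ℝ≥0∞) [hp : Fact (1 ≤ p)] (hq : 1 ≤ q) (s : ℝ)
    (hs : (n : ℝ) * (p⁻¹).toReal - n < s) (M : ℕ) (hMs : s < M) :
    ∃ C : ℝ≥0∞, C ≠ ∞ ∧ ∀ (K : ℕ) (a : Fin K → Rn n), (∀ k, ‖a k‖ = 1) →
      ∀ (m : ℕ), 1 ≤ m → ∀ (L : ℕ) (b : ℕ → ℂ) (f : Fin K → 𝓢(Rn n, ℂ)),
        besovNorm φ₀ s p q (oscSum a L (2 ^ m) b f : 𝓢'(Rn n, ℂ)) ≤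
          C * coeffNorm s q L (2 ^ m) b * ∑ k : Fin K, eLpNorm (f k) p volume +
            C * farSum s p M L (2 ^ m) b f := by
  obtain ⟨w, hw, hfar⟩ := exists_far_bound hφ₀ p hp.out s hs M hMs
  set A : ℝ≥0∞ := ∑ r ∈ Finset.Icc (-2 : ℤ) 2,
    ENNReal.ofReal ((2 : ℝ) ^ (s * r)) * eLpNorm φ₀ 1 volume with hA
  have hAt : A ≠ ∞ := ENNReal.sum_ne_top.2 fun r _ =>
    ENNReal.mul_ne_top ENNReal.ofReal_ne_top (φ₀.memLp 1 volume).eLpNorm_ne_top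
  refine ⟨A + ∑' d, w d, ENNReal.add_ne_top.2 ⟨hAt, hw⟩, fun K a ha m hm L b f => ?_⟩
  have hpow : ∀ l : ℕ, ((2 : ℝ) ^ m) ^ l = 2 ^ (m * l) := fun l => (pow_mul _ _ _).symm
  set S : ℝ≥0∞ := ∑ k : Fin K, eLpNorm (f k) p volume with hS
  let Y : Finset.Icc 1 L → ℝ≥0∞ := fun l => ∑ k : Fin K,
    ENNReal.ofReal (((2 : ℝ) ^ (m * l)) ^ (s + n * (1 - (p⁻¹).toReal) - M)) *
      gradLpL1Norm M p (f k)
  let c : Finset.Icc 1 L → ℝ≥0∞ := fun l => ENNReal.ofReal (((2 : ℝ) ^ m) ^ (s * (l : ℕ)) * ‖b l‖)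
  have hc : ∀ l, c l = ENNReal.ofReal (((2 : ℝ) ^ (m * l)) ^ s) * ‖b l‖ₑ := fun l => by
    rw [← hpow]; exact ofReal_rpow_mul_norm (by positivity) s l (b l)
  -- `e r l` is the block at offset r from carrier l. For fixed r these blocks are distinct because
  -- m ≥ 1.
  let e : ℤ → Finset.Icc 1 L → ℤ := fun r l => ((m * l : ℕ) : ℤ) + r
  have he : ∀ r, Function.Injective (e r) := by
    intro r l l' h
    have h1 : m * (l : ℕ) = m * l' := by exact_mod_cast add_right_cancel h
    exact Subtype.ext (Nat.eq_of_mul_eq_mul_left hm h1)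
  let D : ℤ → ℝ≥0∞ := fun r => ENNReal.ofReal ((2 : ℝ) ^ (s * r)) * eLpNorm φ₀ 1 volume * S
  have hpt : ∀ j : ℤ, blockNorm φ₀ s p j (oscSum a L (2 ^ m) b f) ≤
      (∑ r ∈ Finset.Icc (-2 : ℤ) 2, D r * ∑ l, if e r l = j then c l else 0) +
        ∑ l : Finset.Icc 1 L, ‖b l‖ₑ * (w (j - (m * l : ℕ)) * Y l) := by
    intro j
    rw [oscSum_eq]
    refine (blockNorm_oscSum_le hp.out _ _ _ _).trans ?_
    simp only [Finset.mul_sum (Finset.univ : Finset (Finset.Icc 1 L))]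
    rw [Finset.sum_comm, ← Finset.sum_add_distrib]
    refine Finset.sum_le_sum fun l _ => ?_
    rw [hpow]
    -- Each layer is charged to exactly one sum: near block j, with offset r in [-2, 2], or far
    -- block.
    rcases lt_or_ge |j - ((m * l : ℕ) : ℤ)| 3 with h | h
    · refine le_add_right ?_
      obtain ⟨r, hr⟩ : ∃ r : ℤ, r = j - ((m * l : ℕ) : ℤ) := ⟨_, rfl⟩
      have hj : j = ((m * l : ℕ) : ℤ) + r := by omega
      have hrm : r ∈ Finset.Icc (-2 : ℤ) 2 := by
        rw [← hr, abs_lt] at h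
        rw [Finset.mem_Icc]; omega
      refine le_trans ?_ (Finset.single_le_sum (fun _ _ => zero_le) hrm)
      rw [if_pos hj.symm, hc, hj]
      calc _ ≤ ‖b l‖ₑ * ∑ k : Fin K, ENNReal.ofReal ((2 : ℝ) ^ (s * r)) * eLpNorm φ₀ 1 volume *
            (ENNReal.ofReal (((2 : ℝ) ^ (m * l)) ^ s) * eLpNorm (f k) p volume) := by
            gcongr with k
            exact blockNorm_modulate_le hp.out _ _ _ _
        _ = _ := by
            simp only [D]
            rw [← Finset.mul_sum, ← Finset.mul_sum]
            ring
    · refine le_add_left ?_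
      simp only [Y]
      rw [Finset.mul_sum (Finset.univ : Finset (Fin K)) _ (w _)]
      gcongr with k
      exact hfar _ _ h _ (ha k) _
  rw [besovNorm_coe]
  refine (lqNorm_mono hpt).trans ((lqNorm_add_le hq _ _).trans (add_le_add ?_ ?_))
  · refine (lqNorm_sum_le hq _ _).trans ?_
    calc _ ≤ ∑ r ∈ Finset.Icc (-2 : ℤ) 2, D r * coeffNorm s q L (2 ^ m) b := by
          gcongr with r
          rw [lqNorm_const_mul hq]
          gcongr
          exact lqNorm_sum_ite_le hq (he r) c
      _ = A * coeffNorm s q L (2 ^ m) b * S := by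
          simp only [D]
          rw [hA, ← Finset.sum_mul, ← Finset.sum_mul]
          ring
      _ ≤ _ := by
          gcongr
          exact le_self_add
  · refine (lqNorm_le_tsum hq _).trans ?_
    rw [Summable.tsum_finsetSum fun _ _ => ENNReal.summable]
    rw [farSum_eq _ _ _ _ (by positivity), Finset.mul_sum]
    refine Finset.sum_le_sum fun l _ => ?_
    rw [ENNReal.tsum_mul_left, ENNReal.tsum_mul_right, tsum_shift_eq]
    simp only [hpow, Y]
    rw [← mul_assoc, ← mul_assoc, mul_comm ‖b l‖ₑ]
    gcongr
    exact le_add_self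

end

/-! ### The lower bound. -/

section

variable {n : ℕ}

/-- For |r| ≥ 2 the point 2^{-r}ξ leaves the annulus supporting the generator, so only three terms
of the partition of unity survive. -/
theorem IsLittlewoodPaley.sum_Icc_eq_one {φ₀ : 𝓢(Rn n, ℂ)} (hφ₀ : IsLittlewoodPaley φ₀) {ξ : Rn n}
    (h1 : 3 / 4 < ‖ξ‖) (h2 : ‖ξ‖ < 5 / 4) :
    ∑ r ∈ Finset.Icc (-1 : ℤ) 1, dyadicSymbol φ₀ r ξ = 1 := by
  have hξ : ξ ≠ 0 := by
    rintro rfl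
    simp at h1
    linarith
  refine (hasSum_sum_of_ne_finset_zero fun r hr => ?_).unique (hφ₀.hasSum_one ξ hξ)
  refine hφ₀.eq_zero ?_
  rw [norm_smul, Real.norm_of_nonneg (by positivity)]
  rw [Finset.mem_Icc, not_and_or, not_le, not_le] at hr
  rcases hr with hr | hr
  · right
    have : (4 : ℝ) ≤ 2 ^ (-r) := calc
      (4 : ℝ) = 2 ^ (2 : ℤ) := by norm_num
      _ ≤ _ := zpow_le_zpow_right₀ one_le_two (by omega)
    nlinarith
  · left
    have : (2 : ℝ) ^ (-r) ≤ 1 / 4 := calc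
      (2 : ℝ) ^ (-r) ≤ 2 ^ (-2 : ℤ) := zpow_le_zpow_right₀ one_le_two (by omega)
      _ = 1 / 4 := by norm_num
    nlinarith [norm_nonneg ξ]

/-- A kernel with frequencies near the unit sphere, dilated to frequency `2^i`, only sees three
Littlewood-Paley blocks. -/
theorem IsLittlewoodPaley.schwartzConv_dilate_eq_sum {φ₀ : 𝓢(Rn n, ℂ)} (hφ₀ : IsLittlewoodPaley φ₀)
    {κ : 𝓢(Rn n, ℂ)} (hκ : ∀ ξ, angularFourier κ ξ ≠ 0 → 3 / 4 < ‖ξ‖ ∧ ‖ξ‖ < 5 / 4) (i : ℕ)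
    (f : 𝓢(Rn n, ℂ)) :
    schwartzConv (dilate (2 ^ i) κ) f = ∑ r ∈ Finset.Icc (-1 : ℤ) 1,
      schwartzConv (dilate (2 ^ i) κ) (schwartzConv (dilate ((2 : ℝ) ^ ((i : ℤ) + r)) φ₀) f) := by
  rw [← map_sum]
  refine schwartz_ext_fourier fun η => ?_
  have hi : (0 : ℝ) < 2 ^ i := by positivity
  have hsum : 𝓕 (∑ r ∈ Finset.Icc (-1 : ℤ) 1,
      schwartzConv (dilate ((2 : ℝ) ^ ((i : ℤ) + r)) φ₀) f) η =
      (∑ r ∈ Finset.Icc (-1 : ℤ) 1,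
        dyadicSymbol φ₀ r (((2 : ℝ) ^ i)⁻¹ • (2 * Real.pi) • η)) * 𝓕 f η := by
    rw [FourierTransform.fourier_sum, sum_apply, Finset.sum_mul]
    refine Finset.sum_congr rfl fun r _ => ?_
    rw [fourier_schwartzConv, fourier_dilate (by positivity), fourier_eq_angularFourier,
      dyadicSymbol, smul_eq_mul, smul_smul ((2 : ℝ) ^ (-r)), smul_comm _ (2 * Real.pi)]
    congr 4
    rw [zpow_add₀ two_ne_zero, mul_inv, zpow_neg, zpow_natCast, mul_comm]
  rw [fourier_schwartzConv, fourier_schwartzConv, hsum, fourier_dilate hi,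
    fourier_eq_angularFourier, smul_comm (2 * Real.pi)]
  by_cases h : angularFourier κ (((2 : ℝ) ^ i)⁻¹ • (2 * Real.pi) • η) = 0
  · rw [h, zero_smul, zero_smul]
  · obtain ⟨h1, h2⟩ := hκ _ h
    rw [hφ₀.sum_Icc_eq_one h1 h2, one_mul]

/-- The localised piece is rebuilt from three blocks; 2^{|s|} pays for replacing the weight 2^{is}
by 2^{(i+r)s} with |r| ≤ 1. -/
theorem ofReal_rpow_mul_eLpNorm_le_sum_blockNorm {φ₀ : 𝓢(Rn n, ℂ)} (hφ₀ : IsLittlewoodPaley φ₀)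
    {κ : 𝓢(Rn n, ℂ)} (hκ : ∀ ξ, angularFourier κ ξ ≠ 0 → 3 / 4 < ‖ξ‖ ∧ ‖ξ‖ < 5 / 4)
    {p : ℝ≥0∞} (hp : 1 ≤ p) (s : ℝ) (i : ℕ) (f : 𝓢(Rn n, ℂ)) :
    ENNReal.ofReal (((2 : ℝ) ^ i) ^ s) * eLpNorm (schwartzConv (dilate (2 ^ i) κ) f) p volume ≤
      ENNReal.ofReal (2 ^ |s|) * eLpNorm κ 1 volume *
        ∑ r ∈ Finset.Icc (-1 : ℤ) 1, blockNorm φ₀ s p (i + r) f := by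
  rw [hφ₀.schwartzConv_dilate_eq_sum hκ, Finset.mul_sum]
  refine (mul_le_mul_right (eLpNorm_schwartz_sum_le hp _ _) _).trans ?_
  rw [Finset.mul_sum]
  refine Finset.sum_le_sum fun r hr => ?_
  have h := eLpNorm_schwartzConv_le hp (dilate (2 ^ i) κ)
    (schwartzConv (dilate ((2 : ℝ) ^ ((i : ℤ) + r)) φ₀) f)
  rw [eLpNorm_one_dilate (by positivity)] at h
  have hw : ENNReal.ofReal (((2 : ℝ) ^ i) ^ s) ≤
      ENNReal.ofReal (2 ^ |s|) * ENNReal.ofReal ((2 : ℝ) ^ (s * ((i + r : ℤ) : ℝ))) := by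
    rw [← ENNReal.ofReal_mul (by positivity), ← Real.rpow_natCast, ← Real.rpow_mul zero_le_two,
      ← Real.rpow_add two_pos]
    refine ENNReal.ofReal_le_ofReal (Real.rpow_le_rpow_of_exponent_le one_le_two ?_)
    have hr' : |(r : ℝ)| ≤ 1 := by
      rw [Finset.mem_Icc] at hr
      exact abs_le.2 ⟨by exact_mod_cast hr.1, by exact_mod_cast hr.2⟩
    have : |s * r| ≤ |s| := by
      rw [abs_mul]; exact mul_le_of_le_one_right (abs_nonneg s) hr'
    push_cast
    linarith [(abs_le.1 this).1]
  refine (mul_le_mul' hw h).trans_eq ?_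
  rw [blockNorm]
  ring

/-- Convolving a modulated amplitude with a kernel dilated to the carrier frequency multiplies it by
the value of the symbol at the carrier direction, up to first derivatives of the amplitude. -/
theorem eLpNorm_schwartzConv_dilate_modulate_sub_le {p : ℝ≥0∞} (hp : 1 ≤ p) (κ : 𝓢(Rn n, ℂ))
    {N : ℝ} (hN : 0 < N) (a : Rn n) (f : 𝓢(Rn n, ℂ)) :
    eLpNorm (schwartzConv (dilate N κ) (modulate N a f) - angularFourier κ a • modulate N a f :
        𝓢(Rn n, ℂ)) p volume ≤
      ENNReal.ofReal N⁻¹ * firstMoment κ * gradLpNorm 1 p f := by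
  have hN1 : modulate (-N) a (dilate N κ) = dilate N (modulate (-1) a κ) := by
    rw [← modulate_dilate κ hN, mul_neg_one]
  have hint : ∫ y, dilate N (modulate (-1) a κ) y = angularFourier κ a := by
    have h := fourier_dilate hN (modulate (-1) a κ) 0
    rw [SchwartzMap.fourier_coe, Real.fourier_eq', smul_zero, fourier_modulate] at h
    simpa [angularFourier] using h
  have hle := eLpNorm_schwartzConv_sub_le hp (dilate N (modulate (-1) a κ)) f
  rw [hint, firstMoment_dilate hN, firstMoment_modulate, ← gradLpNorm_one] at hle
  refine le_of_eq_of_le ?_ hle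
  rw [schwartzConv_modulate, hN1, ← map_smul, ← map_sub, eLpNorm_modulate]
  rfl

/-- Finitely many distinct directions have positive mutual distance, so a narrow bump at a_k avoids
the others. -/
theorem exists_separating_kernel {K : ℕ} {a : Fin K → Rn n} (ha : ∀ k, ‖a k‖ = 1)
    (ha_inj : Function.Injective a) (k : Fin K) :
    ∃ κ : 𝓢(Rn n, ℂ), (∀ k', angularFourier κ (a k') = if k' = k then 1 else 0) ∧
      ∀ ξ, angularFourier κ ξ ≠ 0 → 3 / 4 < ‖ξ‖ ∧ ‖ξ‖ < 5 / 4 := by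
  -- Radius at most 1/4 keeps the spectrum in the shell 3/4 < |ξ| < 5/4.
  obtain ⟨δ, hδ, hδ4, hsep⟩ : ∃ δ : ℝ, 0 < δ ∧ δ ≤ 1 / 4 ∧ ∀ k', k' ≠ k → δ ≤ ‖a k' - a k‖ := by
    have hev : ∀ᶠ δ : ℝ in nhdsWithin 0 (Set.Ioi 0), ∀ k', k' ≠ k → δ ≤ ‖a k' - a k‖ := by
      refine Filter.eventually_all.2 fun k' => ?_
      by_cases h : k' = k
      · exact Filter.Eventually.of_forall fun _ h' => absurd h h'
      · have : 0 < ‖a k' - a k‖ := norm_pos_iff.2 (sub_ne_zero.2 fun h' => h (ha_inj h'))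
        filter_upwards [Ioo_mem_nhdsGT this] with δ hδ _ using hδ.2.le
    obtain ⟨δ, h1, h2⟩ := (hev.and (Ioo_mem_nhdsGT (by norm_num : (0 : ℝ) < 1 / 4))).exists
    exact ⟨δ, h2.1, h2.2.le, h1⟩
  obtain ⟨κ, hκ1, hκ0⟩ := exists_bump_kernel (a k) hδ
  refine ⟨κ, fun k' => ?_, fun ξ hξ => ?_⟩
  · split_ifs with h
    · rw [h, hκ1]
    · exact hκ0 _ (hsep k' h)
  · have h : ‖ξ - a k‖ < δ := by
      by_contra h
      exact hξ (hκ0 ξ (not_lt.1 h))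
    have h1 := norm_sub_norm_le (a k) ξ
    have h2 := norm_sub_norm_le ξ (a k)
    rw [norm_sub_rev] at h1
    rw [ha] at h1 h2
    constructor <;> linarith

/-- The contribution of the first derivatives of the amplitudes, up to a constant. -/
def gradSum (s : ℝ) (p : ℝ≥0∞) (L : ℕ) (lam : ℝ) {K : ℕ} (b : ℕ → ℂ)
    (f : Fin K → 𝓢(Rn n, ℂ)) : ℝ≥0∞ :=
  ∑ k : Fin K, ∑ l ∈ Finset.Icc 1 L,
    ENNReal.ofReal (lam ^ ((s - 1) * l) * ‖b l‖) * gradLpNorm 1 p (f k)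

theorem gradSum_eq (s : ℝ) (p : ℝ≥0∞) (L : ℕ) {lam : ℝ} (hlam : 0 < lam) {K : ℕ} (b : ℕ → ℂ)
    (f : Fin K → 𝓢(Rn n, ℂ)) :
    gradSum s p L lam b f = ∑ l : Finset.Icc 1 L, ‖b l‖ₑ * ∑ k : Fin K,
      ENNReal.ofReal ((lam ^ (l : ℕ)) ^ s) * ENNReal.ofReal (lam ^ (l : ℕ))⁻¹ *
        gradLpNorm 1 p (f k) := by
  rw [gradSum, Finset.sum_comm, ← Finset.sum_coe_sort]
  refine Finset.sum_congr rfl fun l _ => ?_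
  rw [Finset.mul_sum]
  refine Finset.sum_congr rfl fun k _ => ?_
  rw [ofReal_rpow_mul_norm hlam, Real.rpow_sub_one (by positivity), div_eq_mul_inv,
    ENNReal.ofReal_mul (by positivity)]
  ring

/-- A single amplitude is controlled by the part of the sum seen by the separating kernel, the
remaining carriers, and first derivatives. -/
theorem eLpNorm_le_of_separating {K : ℕ} {a : Fin K → Rn n} {k : Fin K} {κ : 𝓢(Rn n, ℂ)}
    (hκ : ∀ k', angularFourier κ (a k') = if k' = k then 1 else 0) {p : ℝ≥0∞} (hp : 1 ≤ p)
    {N : ℝ} (hN : 0 < N) (c : ℂ) (f : Fin K → 𝓢(Rn n, ℂ)) (G : 𝓢(Rn n, ℂ)) :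
    ‖c‖ₑ * eLpNorm (f k) p volume ≤
      eLpNorm (schwartzConv (dilate N κ) (∑ k', c • modulate N (a k') (f k') + G)) p volume +
      eLpNorm (schwartzConv (dilate N κ) G) p volume +
      ‖c‖ₑ * ∑ k', ENNReal.ofReal N⁻¹ * firstMoment κ * gradLpNorm 1 p (f k') := by
  have hid : c • modulate N (a k) (f k) =
      schwartzConv (dilate N κ) (∑ k', c • modulate N (a k') (f k') + G) -
        schwartzConv (dilate N κ) G -
        c • ∑ k', (schwartzConv (dilate N κ) (modulate N (a k') (f k')) -
          angularFourier κ (a k') • modulate N (a k') (f k')) := by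
    rw [Finset.sum_sub_distrib, map_add, add_sub_cancel_right, map_sum]
    simp only [map_smul, hκ, ite_smul, one_smul, zero_smul, Finset.sum_ite_eq', Finset.mem_univ,
      if_true]
    rw [smul_sub, Finset.smul_sum, sub_sub_cancel]
  rw [← eLpNorm_modulate N (a k), ← eLpNorm_schwartz_smul, hid]
  refine (eLpNorm_schwartz_sub_le hp _ _).trans (add_le_add (eLpNorm_schwartz_sub_le hp _ _) ?_)
  rw [eLpNorm_schwartz_smul]
  gcongr
  refine (eLpNorm_schwartz_sum_le hp _ _).trans (Finset.sum_le_sum fun k' _ => ?_)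
  exact eLpNorm_schwartzConv_dilate_modulate_sub_le hp κ hN (a k') (f k')

theorem exists_lower_bound {φ₀ : 𝓢(Rn n, ℂ)} (hφ₀ : IsLittlewoodPaley φ₀)
    (p q : ℝ≥0∞) [hp : Fact (1 ≤ p)] (hq : 1 ≤ q) (s : ℝ)
    (hs : (n : ℝ) * (p⁻¹).toReal - n < s) (M : ℕ) (hMs : s < M)
    {K : ℕ} {a : Fin K → Rn n} (ha : ∀ k, ‖a k‖ = 1) (ha_inj : Function.Injective a)
    (k : Fin K) :
    ∃ C : ℝ≥0∞, C ≠ ∞ ∧ ∀ (m : ℕ), 4 ≤ m → ∀ (L : ℕ) (b : ℕ → ℂ) (f : Fin K → 𝓢(Rn n, ℂ)),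
        coeffNorm s q L (2 ^ m) b * eLpNorm (f k) p volume ≤
          C * (besovNorm φ₀ s p q (oscSum a L (2 ^ m) b f : 𝓢'(Rn n, ℂ)) +
            gradSum s p L (2 ^ m) b f + farSum s p M L (2 ^ m) b f) := by
  classical
  obtain ⟨w, hw, hfar⟩ := exists_far_bound hφ₀ p hp.out s hs M hMs
  obtain ⟨κ, hκ, hκs⟩ := exists_separating_kernel ha ha_inj k
  set B : ℝ≥0∞ := ENNReal.ofReal (2 ^ |s|) * eLpNorm κ 1 volume with hB
  have hBt : B ≠ ∞ := ENNReal.mul_ne_top ENNReal.ofReal_ne_top (κ.memLp 1 volume).eLpNorm_ne_top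
  set W : ℝ≥0∞ := ∑' d, w d with hW
  -- The three terms pay for the Besov norm, the gradient error and the other layers; 3 counts the
  -- offsets -1, 0, 1.
  refine ⟨3 * B + firstMoment κ + 3 * B * W, by
    simp [ENNReal.mul_ne_top, hBt, hw, firstMoment_ne_top κ],
    fun m hm L b f => ?_⟩
  have hpow : ∀ l : ℕ, ((2 : ℝ) ^ m) ^ l = 2 ^ (m * l) := fun l => (pow_mul _ _ _).symm
  let u : Finset.Icc 1 L → ℝ≥0∞ := fun l => ENNReal.ofReal (((2 : ℝ) ^ (m * l)) ^ s)
  let c : Finset.Icc 1 L → ℝ≥0∞ := fun l => ENNReal.ofReal (((2 : ℝ) ^ m) ^ (s * (l : ℕ)) * ‖b l‖)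
  have hc : ∀ l, c l = u l * ‖b l‖ₑ := fun l => by
    simp only [u]
    rw [← hpow]; exact ofReal_rpow_mul_norm (by positivity) s l (b l)
  let Y : Finset.Icc 1 L → ℝ≥0∞ := fun l => ∑ k : Fin K,
    ENNReal.ofReal (((2 : ℝ) ^ (m * l)) ^ (s + n * (1 - (p⁻¹).toReal) - M)) *
      gradLpL1Norm M p (f k)
  let Z : Finset.Icc 1 L → ℝ≥0∞ := fun l => ∑ k : Fin K,
    u l * ENNReal.ofReal ((2 : ℝ) ^ (m * l))⁻¹ * gradLpNorm 1 p (f k)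
  let x : ℤ → ℝ≥0∞ := fun j => blockNorm φ₀ s p j (oscSum a L (2 ^ m) b f)
  let e : ℤ → Finset.Icc 1 L → ℤ := fun r l => ((m * l : ℕ) : ℤ) + r
  have he : ∀ r, Function.Injective (e r) := by
    intro r l l' h
    have h1 : m * (l : ℕ) = m * l' := by exact_mod_cast add_right_cancel h
    exact Subtype.ext (Nat.eq_of_mul_eq_mul_left (by omega) h1)
  let I : Finset ℤ := Finset.Icc (-1) 1
  have hpt : ∀ l, c l * eLpNorm (f k) p volume ≤
      B * (∑ r ∈ I, x (e r l)) + firstMoment κ * (‖b l‖ₑ * Z l) +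
        B * ∑ r ∈ I, ∑ l' : Finset.Icc 1 L, ‖b l'‖ₑ * Y l' * w (e r l - (m * l' : ℕ)) := by
    intro l
    have hN : (0 : ℝ) < 2 ^ (m * (l : ℕ)) := by positivity
    -- G collects every layer other than l.
    set G : 𝓢(Rn n, ℂ) := ∑ l' ∈ Finset.univ.erase l, ∑ k : Fin K,
      b l' • modulate (2 ^ (m * (l' : ℕ))) (a k) (f k) with hG
    have hF : oscSum a L (2 ^ m) b f =
        ∑ k' : Fin K, b l • modulate (2 ^ (m * (l : ℕ))) (a k') (f k') + G := by
      rw [oscSum_eq, hG, ← Finset.add_sum_erase _ _ (Finset.mem_univ l)]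
      simp only [hpow]
    have h1 := eLpNorm_le_of_separating hκ hp.out hN (b l) f G
    rw [← hF] at h1
    have h2 := ofReal_rpow_mul_eLpNorm_le_sum_blockNorm hφ₀ hκs hp.out s (m * (l : ℕ))
      (oscSum a L (2 ^ m) b f)
    have h3 := ofReal_rpow_mul_eLpNorm_le_sum_blockNorm hφ₀ hκs hp.out s (m * (l : ℕ)) G
    have h4 : ∀ r ∈ I, blockNorm φ₀ s p (e r l) G ≤
        ∑ l' : Finset.Icc 1 L, ‖b l'‖ₑ * Y l' * w (e r l - (m * l' : ℕ)) := by
      intro r hr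
      refine (blockNorm_oscSum_le hp.out _ _ (fun l' : Finset.Icc 1 L => b l') _).trans ?_
      refine (Finset.sum_le_sum fun l' hl' => ?_).trans
        (Finset.sum_le_sum_of_subset (Finset.erase_subset l _))
      rw [mul_assoc, mul_comm (Y l')]
      simp only [Y]
      rw [Finset.mul_sum (Finset.univ : Finset (Fin K)) _ (w _)]
      gcongr with k'
      refine hfar _ _ ?_ _ (ha k') _
      have hne : (l' : ℕ) ≠ l := fun h => (Finset.mem_erase.1 hl').1 (Subtype.ext h)
      rw [Finset.mem_Icc] at hr
      -- Distinct carriers are at least m ≥ 4 octaves apart, so an offset of at most 1 leaves the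
      -- distance 3 required for far blocks.
      have h5 : (m : ℤ) ≤ |(m : ℤ) * ((l : ℕ) - (l' : ℕ))| := by
        rw [abs_mul, abs_of_nonneg (by positivity)]
        refine le_mul_of_one_le_right (by positivity) (Int.one_le_abs ?_)
        omega
      simp only [e]
      push_cast
      rw [mul_sub] at h5
      rw [le_abs] at h5 ⊢
      omega
    calc c l * eLpNorm (f k) p volume = u l * (‖b l‖ₑ * eLpNorm (f k) p volume) := by
          rw [hc, mul_assoc]
      _ ≤ u l * _ := mul_le_mul_right h1 _
      _ = u l * eLpNorm (schwartzConv (dilate (2 ^ (m * (l : ℕ))) κ)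
            (oscSum a L (2 ^ m) b f)) p volume +
          firstMoment κ * (‖b l‖ₑ * Z l) +
          u l * eLpNorm (schwartzConv (dilate (2 ^ (m * (l : ℕ))) κ) G) p volume := by
          simp only [Z]
          rw [← Finset.mul_sum, ← Finset.mul_sum]
          ring
      _ ≤ _ := by
          refine add_le_add (add_le_add h2 le_rfl) (h3.trans ?_)
          gcongr with r hr
          exact h4 r hr
  clear_value B
  have hcard : ∀ t : ℝ≥0∞, ∑ _r ∈ I, t = 3 * t := fun t => by simp [I]
  rw [mul_comm]
  change eLpNorm (f k) p volume * lqNorm q c ≤ _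
  rw [← lqNorm_const_mul hq]
  simp only [mul_comm (eLpNorm (f k) p volume)]
  have hx : lqNorm q (fun l => B * ∑ r ∈ I, x (e r l)) ≤ 3 * B *
      besovNorm φ₀ s p q (oscSum a L (2 ^ m) b f : 𝓢'(Rn n, ℂ)) := by
    rw [lqNorm_const_mul hq, besovNorm_coe, mul_comm 3 B, mul_assoc B, ← hcard]
    gcongr
    refine (lqNorm_sum_le hq _ _).trans (Finset.sum_le_sum fun r _ => ?_)
    exact lqNorm_comp_le (he r) x
  have hz : lqNorm q (fun l : Finset.Icc 1 L => firstMoment κ * (‖b l‖ₑ * Z l)) ≤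
      firstMoment κ * gradSum s p L (2 ^ m) b f := by
    rw [lqNorm_const_mul hq, gradSum_eq _ _ _ (by positivity)]
    gcongr
    refine (lqNorm_le_tsum hq _).trans_eq ?_
    rw [tsum_fintype]
    simp only [hpow, Z, u]
  have hy : lqNorm q (fun l : Finset.Icc 1 L => B * ∑ r ∈ I, ∑ l' : Finset.Icc 1 L,
      ‖b l'‖ₑ * Y l' * w (e r l - (m * l' : ℕ))) ≤ 3 * B * W * farSum s p M L (2 ^ m) b f := by
    rw [lqNorm_const_mul hq, mul_comm 3 B, mul_assoc B, mul_assoc B, mul_assoc 3, ← hcard]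
    gcongr
    refine (lqNorm_sum_le hq _ _).trans (Finset.sum_le_sum fun r _ => ?_)
    refine (lqNorm_sum_le hq _ _).trans ?_
    rw [farSum_eq _ _ _ _ (by positivity), Finset.mul_sum]
    refine Finset.sum_le_sum fun l' _ => ?_
    rw [lqNorm_const_mul hq, mul_comm]
    simp only [hpow]
    refine mul_le_mul' ?_ le_rfl
    -- As l varies the indices `e r l` are distinct, so for fixed l' the weights add up to at most
    -- W.
    refine (lqNorm_comp_le (a := fun j => w (j - (m * l' : ℕ))) (he r)).trans ?_
    exact (lqNorm_le_tsum hq _).trans_eq (tsum_shift_eq w _)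
  calc _ ≤ _ := lqNorm_mono hpt
    _ ≤ _ := (lqNorm_add_le hq _ _).trans (add_le_add (lqNorm_add_le hq _ _) le_rfl)
    _ ≤ _ := add_le_add (add_le_add hx hz) hy
    _ ≤ _ := by
      rw [mul_add, mul_add]
      gcongr
      · exact le_add_right le_self_add
      · exact le_add_right le_add_self
      · exact le_add_self

end

end OscBesov

end

/-- Upper and lower Besov estimates for superpositions of modulated Schwartz amplitudes. All
quantities live in `[0, ∞]`; the subtracted terms of the lower bound, which are finite because the
amplitudes are Schwartz functions, stand on the side of the Besov norm. -/
theorem proposition3p1 (n : ℕ)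
    (φ₀ : 𝓢(OscBesov.Rn n, ℂ)) (hφ₀ : OscBesov.IsLittlewoodPaley φ₀)
    (p q : ℝ≥0∞) [Fact (1 ≤ p)] (hq : 1 ≤ q)
    (s : ℝ) (hs : (n : ℝ) * (p⁻¹).toReal - n < s)
    (K : ℕ) (hK : 1 ≤ K)
    (a : Fin K → OscBesov.Rn n) (ha : ∀ k, ‖a k‖ = 1) (ha_inj : Function.Injective a)
    (M : ℕ) (hM : 1 ≤ M) (hMs : s < M) :
    ∃ C : ℝ≥0, 0 < C ∧
      ∀ (L : ℕ), 1 ≤ L →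
      ∀ (lam : ℝ), (∃ m : ℕ, 1 ≤ m ∧ lam = 2 ^ m) → 2 ^ 100 ≤ lam →
      ∀ (b : ℕ → ℂ) (f : Fin K → 𝓢(OscBesov.Rn n, ℂ)),
        OscBesov.besovNorm φ₀ s p q (OscBesov.oscSum a L lam b f : 𝓢'(OscBesov.Rn n, ℂ)) ≤
            C * OscBesov.coeffNorm s q L lam b * ∑ k : Fin K, eLpNorm (f k) p volume
            + C * ∑ k : Fin K, ∑ l ∈ Finset.Icc 1 L,
                ENNReal.ofReal (lam ^ ((s + n * (1 - (p⁻¹).toReal) - M) * l) * ‖b l‖) *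
                  OscBesov.gradLpL1Norm M p (f k)
        ∧
        (C : ℝ≥0∞)⁻¹ * OscBesov.coeffNorm s q L lam b * (⨆ k : Fin K, eLpNorm (f k) p volume) ≤
            OscBesov.besovNorm φ₀ s p q (OscBesov.oscSum a L lam b f : 𝓢'(OscBesov.Rn n, ℂ))
            + C * ∑ k : Fin K, ∑ l ∈ Finset.Icc 1 L,
                ENNReal.ofReal (lam ^ ((s - 1) * l) * ‖b l‖) *
                  OscBesov.gradLpNorm 1 p (f k)
            + C * ∑ k : Fin K, ∑ l ∈ Finset.Icc 1 L,
                ENNReal.ofReal (lam ^ ((s + n * (1 - (p⁻¹).toReal) - M) * l) * ‖b l‖) *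
                  OscBesov.gradLpL1Norm M p (f k) := by
  obtain ⟨C₁, hC₁, hupper⟩ := OscBesov.exists_upper_bound hφ₀ p q hq s hs M hMs
  choose C₂ hC₂ hlower using OscBesov.exists_lower_bound hφ₀ p q hq s hs M hMs ha ha_inj
  -- One constant dominates the upper constant and the lower constants of all k. The summand 1 gives
  -- C ≥ 1, so that after multiplying the lower bound by C the error terms, which then carry C²,
  -- still dominate.
  have hCt : 1 + C₁ + ∑ k, C₂ k ≠ ∞ := by
    simp [hC₁, hC₂, ENNReal.sum_eq_top]
  have h1C : 1 ≤ 1 + C₁ + ∑ k, C₂ k := le_add_right le_self_add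
  have hC₁le : C₁ ≤ 1 + C₁ + ∑ k, C₂ k := le_add_right le_add_self
  have hC₂le : ∀ k, C₂ k ≤ 1 + C₁ + ∑ k, C₂ k := fun k =>
    le_add_left (Finset.single_le_sum (f := C₂) (fun _ _ => zero_le) (Finset.mem_univ k))
  generalize 1 + C₁ + ∑ k, C₂ k = C at *
  lift C to ℝ≥0 using hCt
  have hC0 : (C : ℝ≥0∞) ≠ 0 := (zero_lt_one.trans_le h1C).ne'
  refine ⟨C, by exact_mod_cast zero_lt_one.trans_le h1C, ?_⟩
  rintro L - lam ⟨m, -, rfl⟩ hm b f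
  have hm100 : 100 ≤ m := (pow_le_pow_iff_right₀ (one_lt_two (α := ℝ))).1 hm
  refine ⟨(hupper K a ha m (by omega) L b f).trans ?_, ?_⟩
  · rw [OscBesov.farSum]
    gcongr
  · rw [ENNReal.mul_iSup]
    refine iSup_le fun k => ?_
    rw [mul_assoc, ENNReal.inv_mul_le_iff hC0 ENNReal.coe_ne_top]
    refine (hlower k m (by omega) L b f).trans ?_
    rw [OscBesov.farSum, OscBesov.gradSum]
    gcongr
    · exact hC₂le k
    · exact le_mul_of_one_le_left' h1C
    · exact le_mul_of_one_le_left' h1C
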